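/- Let $H$ be a complex Hilbert space, let $X\subseteq B(H)$ be a linear subspace containing the identity operator, and let $C=C^*(X)\subseteq B(H)$ be the $C^*$-algebra generated by $X$. A closed two-sided ideal $J$ of $C$ is called a boundary ideal for $X$ if the restriction to $X$ of the quotient map $q_J\colon C\to C/J$ is completely isometric, i.e. $\|[q_J(x_{ij})]\|_{M_\nu(C/J)}=\|[x_{ij}]\|_{M_\nu(C)}$ for all $\nu\ge 1$ and $[x_{ij}]\in M_\nu(X)$. The Šilov ideal of $X$ in $C$ is the biggest (with respect to inclusion) boundary ideal for $X$ in $C$. A selfadjoint linear subspace $V$ of $C$ is called a boundary subsystem for $X$ in $C$ if the restriction to $X$ of the quotient linear map $q_V\colon C\to C/V\subseteq B(H)/V$ is completely isometric, i.e. $$\inf\{\|[x_{ij}+y_{ij}]\| : y_{ij}\in V\}=\|[x_{ij}]\|\qquad\text{for all } \nu\ge 1,\ [x_{ij}]\in M_\nu(X),$$ the norms being those of $M_\nu(B(H))=B(H^\nu)$. Then the Šilov ideal of $X$ in $C$ exists, and it is the biggest boundary subsystem for $X$ contained in $C$: it is itself a boundary subsystem for $X$ in $C$, and it contains every boundary subsystem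 for $X$ in $C$. -/

import Mathlib

noncomputable section

namespace SilovBoundary

/-! ### The quotient of a unital C*-algebra by a closed two-sided ideal -/

section Quotient

variable {A : Type*} [CStarAlgebra A]

/-- If `b* b` lies in a left ideal `J`, then `J` contains approximate right units for `b`. -/
lemma exists_approx_unit (J : Ideal A) (b : A) (hb : star b * b ∈ J) {δ : ℝ} (hδ : 0 < δ) :
    ∃ e ∈ J, IsSelfAdjoint e ∧ ‖1 - e‖ ≤ 1 ∧ ‖b * (1 - e)‖ ^ 2 ≤ δ := by
  let _ := CStarAlgebra.spectralOrder A
  have _ := CStarAlgebra.spectralOrderedRing A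
  set h : A := star b * b with hh
  have hsa : IsSelfAdjoint h := IsSelfAdjoint.star_mul_self b
  have hspec : ∀ t ∈ spectrum ℝ h, 0 ≤ t := fun t ht =>
    spectrum_nonneg_of_nonneg (star_mul_self_nonneg b) ht
  have hne : ∀ t ∈ spectrum ℝ h, t + δ ≠ 0 := fun t ht => by
    have := hspec t ht; positivity
  have c1 : ContinuousOn (fun t : ℝ => (t + δ)⁻¹) (spectrum ℝ h) :=
    ContinuousOn.inv₀ (by fun_prop) hne
  have c2 : ContinuousOn (fun t : ℝ => δ * (t + δ)⁻¹) (spectrum ℝ h) :=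
    continuousOn_const.mul c1
  have c3 : ContinuousOn (fun t : ℝ => (t + δ)⁻¹ * t) (spectrum ℝ h) :=
    c1.mul continuousOn_id
  have he : cfc (fun t : ℝ => (t + δ)⁻¹ * t) h = cfc (fun t : ℝ => (t + δ)⁻¹) h * h := by
    rw [cfc_mul (fun t : ℝ => (t + δ)⁻¹) (fun t => t) h c1 continuousOn_id, cfc_id' ℝ h]
  have hu : 1 - cfc (fun t : ℝ => (t + δ)⁻¹ * t) h = cfc (fun t : ℝ => δ * (t + δ)⁻¹) h := by
    rw [← cfc_const_one ℝ h, ← cfc_sub (fun _ : ℝ => (1 : ℝ)) _ h continuousOn_const c3]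
    refine cfc_congr fun t ht => ?_
    have := hne t ht
    field_simp
    ring
  have husa : IsSelfAdjoint (cfc (fun t : ℝ => δ * (t + δ)⁻¹) h) := cfc_predicate _ h
  refine ⟨cfc (fun t : ℝ => (t + δ)⁻¹ * t) h, ?_, cfc_predicate _ h, ?_, ?_⟩
  · rw [he]; exact J.mul_mem_left _ hb
  · rw [hu]
    refine norm_cfc_le zero_le_one fun t ht => ?_
    have h0 := hspec t ht
    rw [Real.norm_of_nonneg (by positivity), ← div_eq_mul_inv, div_le_one (by positivity)]
    linarith
  · rw [hu, sq, ← CStarRing.norm_star_mul_self, star_mul, husa.star_eq, mul_assoc,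
      ← mul_assoc (star b), ← hh]
    have : cfc (fun t : ℝ => δ * (t + δ)⁻¹) h * (h * cfc (fun t : ℝ => δ * (t + δ)⁻¹) h)
        = cfc (fun t : ℝ => δ * (t + δ)⁻¹ * (t * (δ * (t + δ)⁻¹))) h := by
      rw [cfc_mul (fun t : ℝ => δ * (t + δ)⁻¹) (fun t : ℝ => t * (δ * (t + δ)⁻¹)) h c2
        (continuousOn_id.mul c2), cfc_mul (fun t : ℝ => t) _ h continuousOn_id c2, cfc_id' ℝ h]
    rw [this]
    refine norm_cfc_le hδ.le fun t ht => ?_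
    have h0 := hspec t ht
    rw [Real.norm_of_nonneg (by positivity)]
    have : δ * (t + δ)⁻¹ * (t * (δ * (t + δ)⁻¹)) = δ * (δ * t / (t + δ) ^ 2) := by
      field_simp
    rw [this]
    refine mul_le_of_le_one_right hδ.le ?_
    rw [div_le_one (by positivity)]
    nlinarith [mul_nonneg hδ.le h0, sq_nonneg t, sq_nonneg δ]

/-- A closed two-sided ideal of a C*-algebra is selfadjoint. -/
lemma star_mem_ideal (J : Ideal A) [J.IsTwoSided] [hJ : IsClosed (J : Set A)] {a : A}
    (ha : a ∈ J) : star a ∈ J := by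
  change star a ∈ (J : Set A)
  rw [← hJ.closure_eq, Metric.mem_closure_iff]
  intro ε hε
  obtain ⟨e, he, -, -, h2⟩ := exists_approx_unit J (star a)
    (J.mul_mem_right _ (by rwa [star_star])) (δ := (ε / 2) ^ 2) (by positivity)
  refine ⟨star a * e, J.mul_mem_left _ he, ?_⟩
  rw [dist_eq_norm, ← mul_one_sub]
  have := le_of_abs_le (abs_le_of_sq_le_sq h2 (by positivity))
  linarith

variable (J : Ideal A) [J.IsTwoSided] [hJ : IsClosed (J : Set A)]

instance quotientNormedRing : NormedRing (A ⧸ J) where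
  __ := Submodule.Quotient.normedAddCommGroup J
  __ := Ideal.Quotient.ring J
  norm_mul_le x y := by
    refine ge_of_tendsto (x := nhdsWithin (0 : ℝ) (Set.Ioi 0))
      (f := fun ε => (‖x‖ + ε) * (‖y‖ + ε)) ?_ ?_
    · have : Continuous fun ε : ℝ => (‖x‖ + ε) * (‖y‖ + ε) := by fun_prop
      simpa using (this.tendsto 0).mono_left nhdsWithin_le_nhds
    · filter_upwards [self_mem_nhdsWithin] with ε hε
      obtain ⟨a, rfl, ha⟩ := Submodule.Quotient.norm_mk_lt x hε
      obtain ⟨b, rfl, hb⟩ := Submodule.Quotient.norm_mk_lt y hε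
      calc _ ≤ ‖a * b‖ := Submodule.Quotient.norm_mk_le J (a * b)
        _ ≤ ‖a‖ * ‖b‖ := norm_mul_le a b
        _ ≤ _ := mul_le_mul ha.le hb.le (norm_nonneg _) ((norm_nonneg _).trans ha.le)

instance quotientNormedAlgebra : NormedAlgebra ℂ (A ⧸ J) where
  __ := (Ideal.Quotient.algebra ℂ : Algebra ℂ (A ⧸ J))
  norm_smul_le c x := (Submodule.Quotient.normedSpace J ℂ).norm_smul_le c x

/-- The involution `(a + J)* = a* + J`. -/
instance quotientStarRing : StarRing (A ⧸ J) where
  star := Quotient.map' star fun a b hab => by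
    rw [Submodule.quotientRel_def] at hab ⊢
    rw [← star_sub]
    exact star_mem_ideal J hab
  star_involutive := by
    rintro ⟨a⟩
    exact congrArg (Ideal.Quotient.mk J) (star_star a)
  star_mul := by
    rintro ⟨a⟩ ⟨b⟩
    exact congrArg (Ideal.Quotient.mk J) (star_mul a b)
  star_add := by
    rintro ⟨a⟩ ⟨b⟩
    exact congrArg (Ideal.Quotient.mk J) (star_add a b)

/-- The quotient C*-algebra `A / J`, with the quotient norm `‖a + J‖ = inf {‖a + j‖ : j ∈ J}`. -/
instance quotientCStarAlgebra : CStarAlgebra (A ⧸ J) where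
  __ := quotientNormedRing J
  __ := quotientStarRing J
  __ := quotientNormedAlgebra J
  toCompleteSpace := Submodule.Quotient.completeSpace J
  star_smul c := by
    rintro ⟨a⟩
    exact congrArg (Ideal.Quotient.mk J) (star_smul c a)
  norm_mul_self_le := by
    rintro ⟨a⟩
    change ‖Ideal.Quotient.mk J a‖ * ‖Ideal.Quotient.mk J a‖ ≤ ‖Ideal.Quotient.mk J (star a * a)‖
    refine le_of_forall_pos_le_add fun ε hε => ?_
    obtain ⟨m, hm, hlt⟩ := Submodule.Quotient.norm_mk_lt (S := J)
      (Ideal.Quotient.mk J (star a * a)) (half_pos hε)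
    have hj : m - star a * a ∈ J := (Submodule.Quotient.eq J).1 hm
    set j := m - star a * a with hjdef
    obtain ⟨e, he, hesa, he1, he2⟩ := exists_approx_unit J j (J.mul_mem_left _ hj)
      (δ := (ε / 2) ^ 2) (by positivity)
    have hje : ‖j * (1 - e)‖ ≤ ε / 2 := le_of_abs_le (abs_le_of_sq_le_sq he2 (by positivity))
    have hsa : star (1 - e) = 1 - e := by rw [star_sub, star_one, hesa.star_eq]
    have hq : ‖Ideal.Quotient.mk J a‖ ≤ ‖a * (1 - e)‖ := by
      have : Ideal.Quotient.mk J a = Ideal.Quotient.mk J (a * (1 - e)) := by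
        refine (Submodule.Quotient.eq J).2 ?_
        rw [mul_one_sub, sub_sub_cancel]
        exact J.mul_mem_left _ he
      rw [this]
      exact Submodule.Quotient.norm_mk_le J _
    calc ‖Ideal.Quotient.mk J a‖ * ‖Ideal.Quotient.mk J a‖
        ≤ ‖a * (1 - e)‖ * ‖a * (1 - e)‖ := by gcongr
      _ = ‖(1 - e) * m * (1 - e) - (1 - e) * (j * (1 - e))‖ := by
          rw [← CStarRing.norm_star_mul_self, star_mul, hsa, hjdef]
          congr 1
          noncomm_ring
      _ ≤ ‖(1 - e) * m * (1 - e)‖ + ‖(1 - e) * (j * (1 - e))‖ := norm_sub_le _ _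
      _ ≤ 1 * ‖m‖ * 1 + 1 * (ε / 2) := by
          gcongr
          · refine (norm_mul_le _ _).trans ?_
            gcongr
            refine (norm_mul_le _ _).trans ?_
            gcongr
          · refine (norm_mul_le _ _).trans ?_
            gcongr
      _ ≤ ‖Ideal.Quotient.mk J (star a * a)‖ + ε := by linarith

end Quotient

/-! ### Matrix norms -/

/-- The norm of the C*-algebra `M_ν(A)`, for a unital C*-algebra `A`; for `A = B(H)` it is the
operator norm of `B(H^ν)`. (The order on `A` only serves to call on `CStarMatrix`; the norm does
not depend on it.) -/
def matrixNorm {A : Type*} [CStarAlgebra A] {ν : ℕ} (a : Matrix (Fin ν) (Fin ν) A) : ℝ :=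
  letI := CStarAlgebra.spectralOrder A
  letI := CStarAlgebra.spectralOrderedRing A
  ‖CStarMatrix.ofMatrix a‖

/-! ### The Šilov ideal -/

/-- A closed two-sided ideal `J` of `C` is a boundary ideal for the subspace `X` of `C` if the
restriction to `X` of the natural `*`-epimorphism `q_J : C → C / J` is completely isometric. -/
def IsBoundaryIdeal {C : Type*} [CStarAlgebra C] (X : Submodule ℂ C) (J : Ideal C) : Prop :=
  ∃ (_ : J.IsTwoSided) (_ : IsClosed (J : Set C)),
    ∀ (ν : ℕ) (x : Matrix (Fin ν) (Fin ν) C), (∀ i j, x i j ∈ X) →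
      matrixNorm (x.map (Ideal.Quotient.mk J)) = matrixNorm x

/-- The Šilov ideal of `X` in `C` is the biggest boundary ideal for `X` in `C`. -/
def IsSilovIdeal {C : Type*} [CStarAlgebra C] (X : Submodule ℂ C) (J : Ideal C) : Prop :=
  IsGreatest {J : Ideal C | IsBoundaryIdeal X J} J

/-! ### Boundary subsystems -/

section Operators

variable {H : Type*} [NormedAddCommGroup H] [InnerProductSpace ℂ H] [CompleteSpace H]

/-- An operator system in `B(H)`. -/
def IsOperatorSystem (S : Submodule ℂ (H →L[ℂ] H)) : Prop :=
  1 ∈ S ∧ ∀ a ∈ S, star a ∈ S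

/-- A selfadjoint subspace `V` of an operator system `S ⊇ X` in `B(H)` is a boundary subsystem for
`X` in `S` if the restriction to `X` of `q_V : S → S / V ⊆ B(H) / V` is completely isometric, where
`‖[x i j] + M_ν(V)‖ = inf {‖[x i j + y i j]‖ : y i j ∈ V}`. -/
structure IsBoundarySubsystem (X S V : Submodule ℂ (H →L[ℂ] H)) : Prop where
  operatorSystem : IsOperatorSystem S
  le : X ≤ S
  subspace : V ≤ S
  selfadjoint : ∀ a ∈ V, star a ∈ V
  isometric : ∀ (ν : ℕ) (x : Matrix (Fin ν) (Fin ν) (H →L[ℂ] H)), (∀ i j, x i j ∈ X) →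
    ⨅ y : {y : Matrix (Fin ν) (Fin ν) (H →L[ℂ] H) // ∀ i j, y i j ∈ V},
      matrixNorm (x + y.1) = matrixNorm x

/-- The C*-algebra `C*(X) ⊆ B(H)` generated by `X` (and the unit). -/
def cstar (X : Submodule ℂ (H →L[ℂ] H)) : StarSubalgebra ℂ (H →L[ℂ] H) :=
  (StarAlgebra.adjoin ℂ (X : Set (H →L[ℂ] H))).topologicalClosure

instance isClosed_cstar (X : Submodule ℂ (H →L[ℂ] H)) :
    IsClosed (cstar X : Set (H →L[ℂ] H)) :=
  StarSubalgebra.isClosed_topologicalClosure _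

/-- The inclusion of `C*(X)` in `B(H)`. -/
def incl (X : Submodule ℂ (H →L[ℂ] H)) : cstar X →ₗ[ℂ] (H →L[ℂ] H) :=
  (cstar X).toSubalgebra.toSubmodule.subtype

end Operators

end SilovBoundary

end

/-! Let Σ be the semigroup of completely positive maps of B(H) that fix X pointwise (`fixingMaps`).
Call c asymptotically annihilated if for every positive functional f and every ε > 0 some θ₀ in Σ
gives |f(θ₀θc)| ≤ ε for all θ in Σ (`Vanishes` with s = 0). The elements of C*(X) with this property
form the Šilov ideal, for three reasons.

They form a closed ideal. For x in X, θ(xx*) ≥ xx* by Schwarz, so f(θ₁θ(xx*)) ≥ f(θ₁(xx*)). These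
values are bounded; once θ₁ is close to the supremum, the Schwarz inequality forces f(θ₁(θ(xw) -
xθ(w))) to be small (`exists_norm_defect_le`). The same holds for x*. So asymptotic annihilation
survives multiplication by C*(X) (`Vanishes.mul_left_of_mem_cstar`).

They form a boundary ideal. Some θ in Σ fixes the entries of x, almost kills those of y in matrix
coefficients, and is completely contractive; so ‖x‖ ≤ ‖x + y‖ (`matrixNorm_le_of_vanishes`).

They contain every boundary subsystem V. The argument for products, run with s = 1 from θ(1) = 1,
shows that all members of Σ agree asymptotically on C*(X). The map x + v ↦ x is completely positive
and extends to some ψ in Σ that kills V (`IsBoundarySubsystem.exists_fixingMap`). Agreement with ψ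
annihilates V asymptotically. Boundary ideals are boundary subsystems, so the ideal is also the
biggest among them. -/

noncomputable section

namespace SilovBoundary

set_option linter.unusedSectionVars false

/-! ### Matrix norms under `*`-homomorphisms -/

section MatrixNorm

variable {A B : Type*} [CStarAlgebra A] [CStarAlgebra B]

lemma matrixNorm_nonneg {ν : ℕ} (a : Matrix (Fin ν) (Fin ν) A) : 0 ≤ matrixNorm a := by
  let _ := CStarAlgebra.spectralOrder A
  let _ := CStarAlgebra.spectralOrderedRing A
  exact norm_nonneg (CStarMatrix.ofMatrix a)

lemma matrixNorm_map_le {ν : ℕ} (φ : A →⋆ₙₐ[ℂ] B) (a : Matrix (Fin ν) (Fin ν) A) :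
    matrixNorm (a.map φ) ≤ matrixNorm a := by
  let _ := CStarAlgebra.spectralOrder A
  let _ := CStarAlgebra.spectralOrderedRing A
  let _ := CStarAlgebra.spectralOrder B
  let _ := CStarAlgebra.spectralOrderedRing B
  exact NonUnitalStarAlgHom.norm_apply_le (CStarMatrix.mapₙₐ (n := Fin ν) φ)
    (CStarMatrix.ofMatrix a)

lemma matrixNorm_map_eq {ν : ℕ} (φ : A →⋆ₙₐ[ℂ] B) (hφ : Function.Injective φ)
    (a : Matrix (Fin ν) (Fin ν) A) : matrixNorm (a.map φ) = matrixNorm a := by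
  let _ := CStarAlgebra.spectralOrder A
  let _ := CStarAlgebra.spectralOrderedRing A
  let _ := CStarAlgebra.spectralOrder B
  let _ := CStarAlgebra.spectralOrderedRing B
  refine NonUnitalStarAlgHom.norm_map (CStarMatrix.mapₙₐ (n := Fin ν) φ) ?_
    (CStarMatrix.ofMatrix a)
  exact CStarMatrix.map_injective hφ

/-- The quotient norm on the image of a `*`-homomorphism of C*-algebras is the norm. -/
lemma exists_norm_add_lt (φ : A →⋆ₐ[ℂ] B) (a : A) {ε : ℝ} (hε : 0 < ε) :
    ∃ k, φ k = 0 ∧ ‖a + k‖ < ‖φ a‖ + ε := by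
  let J : Ideal A := RingHom.ker (φ : A →+* B)
  have hcont : Continuous φ :=
    AddMonoidHomClass.continuous_of_bound φ 1 fun x => by
      simpa using NonUnitalStarAlgHom.norm_apply_le φ x
  have hJ : IsClosed (J : Set A) := isClosed_singleton.preimage hcont
  -- The induced map on A / ker φ is an injective `*`-homomorphism of C*-algebras, hence isometric.
  let ψ : (A ⧸ J) →⋆ₙₐ[ℂ] B :=
    { Ideal.Quotient.lift J (φ : A →+* B) (fun _ h => h) with
      map_smul' := by
        rintro c ⟨x⟩
        exact map_smul φ c x
      map_star' := by
        rintro ⟨x⟩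
        exact map_star φ x }
  have hψ : Function.Injective ψ :=
    RingHom.lift_injective_of_ker_le_ideal J (f := (φ : A →+* B)) (fun _ h => h) le_rfl
  have hn : ‖Ideal.Quotient.mk J a‖ = ‖φ a‖ :=
    (NonUnitalStarAlgHom.norm_map ψ hψ (Ideal.Quotient.mk J a)).symm
  obtain ⟨m, hm, hlt⟩ := Submodule.Quotient.norm_mk_lt (S := J) (Ideal.Quotient.mk J a) hε
  refine ⟨m - a, (Submodule.Quotient.eq J).1 hm, ?_⟩
  rw [add_sub_cancel, ← hn]
  exact hlt

/-- The scalar case applied to the entrywise map M_ν(A) → M_ν(B), whose kernel is M_ν(ker φ). It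
identifies the norm of M_ν(A / J) with a quotient norm. -/
lemma exists_matrixNorm_add_lt {ν : ℕ} (φ : A →⋆ₐ[ℂ] B) (a : Matrix (Fin ν) (Fin ν) A)
    {ε : ℝ} (hε : 0 < ε) :
    ∃ k : Matrix (Fin ν) (Fin ν) A, (∀ i j, φ (k i j) = 0) ∧
      matrixNorm (a + k) < matrixNorm (a.map φ) + ε := by
  let _ := CStarAlgebra.spectralOrder A
  let _ := CStarAlgebra.spectralOrderedRing A
  let _ := CStarAlgebra.spectralOrder B
  let _ := CStarAlgebra.spectralOrderedRing B
  let Φ : CStarMatrix (Fin ν) (Fin ν) A →⋆ₐ[ℂ] CStarMatrix (Fin ν) (Fin ν) B :=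
    { CStarMatrix.mapₙₐ (n := Fin ν) (φ : A →⋆ₙₐ[ℂ] B) with
      map_one' := by
        ext i j
        change φ ((1 : CStarMatrix (Fin ν) (Fin ν) A) i j) = _
        rw [CStarMatrix.one_apply, CStarMatrix.one_apply]
        split_ifs <;> simp
      commutes' := fun r => by
        ext i j
        change φ ((algebraMap ℂ (CStarMatrix (Fin ν) (Fin ν) A) r) i j) = _
        rw [CStarMatrix.algebraMap_apply, CStarMatrix.algebraMap_apply]
        split_ifs
        · exact AlgHomClass.commutes φ r
        · exact map_zero φ }
  obtain ⟨k, hk, hlt⟩ := exists_norm_add_lt Φ (CStarMatrix.ofMatrix a) hε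
  exact ⟨CStarMatrix.ofMatrix.symm k, fun i j => congrFun (congrFun hk i) j, hlt⟩

end MatrixNorm

/-! ### Operator matrices acting on H^ν -/

section Operators

variable (H : Type*) [NormedAddCommGroup H] [InnerProductSpace ℂ H] [CompleteSpace H]

/-- The action of a matrix of operators on column vectors. -/
def matrixAction (ν : ℕ) : CStarMatrix (Fin ν) (Fin ν) (H →L[ℂ] H) →⋆ₙₐ[ℂ]
    (PiLp 2 (fun _ : Fin ν => H) →L[ℂ] PiLp 2 (fun _ : Fin ν => H)) where
  toFun a := (PiLp.continuousLinearEquiv 2 ℂ (fun _ : Fin ν => H)).symm.toContinuousLinearMap ∘L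
    (ContinuousLinearMap.pi fun i => ∑ j, a i j ∘L PiLp.proj 2 (fun _ : Fin ν => H) j)
  map_smul' c a := by ext x i; simp [Finset.smul_sum]
  map_zero' := by ext x i; simp
  map_add' a b := by ext x i; simp [Finset.sum_add_distrib]
  map_mul' a b := by
    ext x i
    simp only [CStarMatrix.mul_apply, ContinuousLinearMap.comp_apply, sum_apply,
      ContinuousLinearMap.coe_pi', ContinuousLinearEquiv.coe_coe,
      PiLp.continuousLinearEquiv_symm_apply, PiLp.proj_apply, mul_apply_eq_comp,
      map_sum]
    exact Finset.sum_comm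
  map_star' a := by
    refine (ContinuousLinearMap.eq_adjoint_iff _ _).2 fun x y => ?_
    simp only [PiLp.inner_apply]
    simp [sum_inner, inner_sum, CStarMatrix.star_apply, ContinuousLinearMap.star_eq_adjoint,
      ContinuousLinearMap.adjoint_inner_left]
    exact Finset.sum_comm

variable {H}

lemma matrixAction_apply {ν : ℕ} (a : Matrix (Fin ν) (Fin ν) (H →L[ℂ] H))
    (ζ : PiLp 2 (fun _ : Fin ν => H)) (i : Fin ν) :
    matrixAction H ν (CStarMatrix.ofMatrix a) ζ i = ∑ j, a i j (ζ j) := by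
  change (∑ j, a i j ∘L PiLp.proj 2 (fun _ : Fin ν => H) j) ζ = _
  simp

lemma inner_matrixAction {ν : ℕ} (a : Matrix (Fin ν) (Fin ν) (H →L[ℂ] H))
    (ζ η : PiLp 2 (fun _ : Fin ν => H)) :
    inner ℂ η (matrixAction H ν (CStarMatrix.ofMatrix a) ζ) =
      ∑ i, ∑ j, inner ℂ (η i) (a i j (ζ j)) := by
  simp only [PiLp.inner_apply, matrixAction_apply, inner_sum]

lemma matrixAction_injective (ν : ℕ) : Function.Injective (matrixAction H ν) := by
  intro a b hab
  ext i j h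
  have := congrArg (fun T => T (WithLp.toLp 2 (Pi.single j h)) i) hab
  change matrixAction H ν (CStarMatrix.ofMatrix (CStarMatrix.ofMatrix.symm a)) _ i =
    matrixAction H ν (CStarMatrix.ofMatrix (CStarMatrix.ofMatrix.symm b)) _ i at this
  rw [matrixAction_apply, matrixAction_apply, Finset.sum_eq_single j, Finset.sum_eq_single j]
    at this
  · simpa using this
  all_goals simp +contextual

lemma matrixNorm_eq_norm_matrixAction {ν : ℕ} (a : Matrix (Fin ν) (Fin ν) (H →L[ℂ] H)) :
    matrixNorm a = ‖matrixAction H ν (CStarMatrix.ofMatrix a)‖ := by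
  let _ := CStarAlgebra.spectralOrder (H →L[ℂ] H)
  let _ := CStarAlgebra.spectralOrderedRing (H →L[ℂ] H)
  exact (NonUnitalStarAlgHom.norm_map (matrixAction H ν) (matrixAction_injective ν) _).symm

end Operators

/-! ### Completely positive maps and Schwarz inequalities, in terms of real parts of forms -/

section Accretive

variable {H : Type*} [NormedAddCommGroup H] [InnerProductSpace ℂ H] [CompleteSpace H]

/-- A matrix of operators whose sesquilinear form has nonnegative real part. -/
def Accretive {ι : Type} [Fintype ι] (A : ι → ι → H →L[ℂ] H) : Prop :=
  ∀ ζ : ι → H, 0 ≤ (∑ i, ∑ j, inner ℂ (ζ i) (A i j (ζ j))).re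

/-- A linear map that preserves accretivity of matrices of all sizes; equivalently, a completely
positive map. -/
def CompletelyAccretive (θ : (H →L[ℂ] H) →ₗ[ℂ] (H →L[ℂ] H)) : Prop :=
  ∀ (ι : Type) [Fintype ι] (A : ι → ι → H →L[ℂ] H), Accretive A →
    Accretive fun i j => θ (A i j)

/-- A functional that is nonnegative on positive operators, phrased by accretivity. -/
def PositiveFunctional (f : (H →L[ℂ] H) →ₗ[ℂ] ℂ) : Prop :=
  ∀ a : H →L[ℂ] H, (∀ ζ, 0 ≤ (inner ℂ ζ (a ζ)).re) → 0 ≤ (f a).re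

/-- The completely positive maps of `B(H)` that fix `X` pointwise. -/
def fixingMaps (X : Submodule ℂ (H →L[ℂ] H)) : Set ((H →L[ℂ] H) →ₗ[ℂ] (H →L[ℂ] H)) :=
  {θ | CompletelyAccretive θ ∧ ∀ x ∈ X, θ x = x}

lemma id_mem_fixingMaps (X : Submodule ℂ (H →L[ℂ] H)) : LinearMap.id ∈ fixingMaps X :=
  ⟨fun _ _ _ h => h, fun _ _ => rfl⟩

lemma comp_mem_fixingMaps {X : Submodule ℂ (H →L[ℂ] H)}
    {θ σ : (H →L[ℂ] H) →ₗ[ℂ] (H →L[ℂ] H)} (hθ : θ ∈ fixingMaps X) (hσ : σ ∈ fixingMaps X) :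
    θ ∘ₗ σ ∈ fixingMaps X :=
  ⟨fun _ _ _ h => hθ.1 _ _ (hσ.1 _ _ h), fun x hx => by
    rw [LinearMap.comp_apply, hσ.2 x hx, hθ.2 x hx]⟩

lemma CompletelyAccretive.accretive {θ : (H →L[ℂ] H) →ₗ[ℂ] (H →L[ℂ] H)}
    (hθ : CompletelyAccretive θ) {a : H →L[ℂ] H} (ha : ∀ ζ, 0 ≤ (inner ℂ ζ (a ζ)).re) (ζ : H) :
    0 ≤ (inner ℂ ζ (θ a ζ)).re := by
  simpa using hθ Unit (fun _ _ => a) (fun ξ => by simpa using ha (ξ ())) (fun _ => ζ)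

lemma PositiveFunctional.comp {f : (H →L[ℂ] H) →ₗ[ℂ] ℂ} (hf : PositiveFunctional f)
    {θ : (H →L[ℂ] H) →ₗ[ℂ] (H →L[ℂ] H)} (hθ : CompletelyAccretive θ) :
    PositiveFunctional (f ∘ₗ θ) :=
  fun _ ha => hf _ (hθ.accretive ha)

lemma inner_star_apply (a : H →L[ℂ] H) (ζ : H) :
    inner ℂ ζ (star a ζ) = star (inner ℂ ζ (a ζ)) := by
  rw [ContinuousLinearMap.star_eq_adjoint, ContinuousLinearMap.adjoint_inner_right]
  exact (inner_conj_symm _ _).symm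

/-- If the form of b has zero real part, then b and -b are both accretive and Re f(b) = 0. The
choices b = a - a* and b = i(a + a*) give the real and imaginary parts. -/
lemma PositiveFunctional.map_star {f : (H →L[ℂ] H) →ₗ[ℂ] ℂ} (hf : PositiveFunctional f)
    (a : H →L[ℂ] H) : f (star a) = star (f a) := by
  have key : ∀ b : H →L[ℂ] H, (∀ ζ, (inner ℂ ζ (b ζ)).re = 0) → (f b).re = 0 := fun b hb => by
    refine le_antisymm ?_ (hf b fun ζ => (hb ζ).ge)
    have := hf (-b) fun ζ => by simp [hb ζ]
    simpa using this
  have h1 := key (a - star a) fun ζ => by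
    rw [sub_apply, inner_sub_right, inner_star_apply, Complex.sub_re, Complex.star_def,
      Complex.conj_re, sub_self]
  have h2 := key (Complex.I • (a + star a)) fun ζ => by
    rw [smul_apply, inner_smul_right, add_apply, inner_add_right, inner_star_apply]
    generalize inner ℂ ζ (a ζ) = z
    simp
  simp at h1 h2
  apply Complex.ext <;> simp <;> linarith

lemma CompletelyAccretive.map_star {θ : (H →L[ℂ] H) →ₗ[ℂ] (H →L[ℂ] H)}
    (hθ : CompletelyAccretive θ) (a : H →L[ℂ] H) : θ (star a) = star (θ a) := by
  rw [← ContinuousLinearMap.coe_inj, ← ext_inner_map]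
  intro ζ
  have hpos : PositiveFunctional
      ((innerSL ℂ ζ).toLinearMap ∘ₗ (ContinuousLinearMap.apply ℂ H ζ).toLinearMap ∘ₗ θ) :=
    fun b hb => hθ.accretive hb ζ
  have := hpos.map_star a
  simp only [LinearMap.comp_apply, ContinuousLinearMap.coe_coe, innerSL_apply_apply,
    ContinuousLinearMap.apply_apply, ← inner_star_apply] at this
  rw [ContinuousLinearMap.coe_coe, ContinuousLinearMap.coe_coe, ← inner_conj_symm, this,
    inner_conj_symm]

lemma map_eq_of_mem_fixingMaps_star {X : Submodule ℂ (H →L[ℂ] H)}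
    {θ : (H →L[ℂ] H) →ₗ[ℂ] (H →L[ℂ] H)} (hθ : θ ∈ fixingMaps X) {x : H →L[ℂ] H}
    (hx : star x ∈ X) : θ x = x := by
  rw [← star_star x, hθ.1.map_star, hθ.2 _ hx]

lemma exists_unit_mul_eq_neg_norm (z : ℂ) : ∃ u : ℂ, ‖u‖ = 1 ∧ (u * z).re = -‖z‖ := by
  by_cases hz : z = 0
  · exact ⟨1, by simp, by simp [hz]⟩
  · have hz' : (‖z‖ : ℂ) ≠ 0 := by simpa using hz
    refine ⟨-(star z / ‖z‖), by simp [hz], ?_⟩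
    have : -(star z / ‖z‖) * z = ((-‖z‖ : ℝ) : ℂ) := by
      have h := Complex.conj_mul' z
      rw [← Complex.star_def] at h
      field_simp
      rw [h]
      push_cast
      ring
    rw [this, Complex.ofReal_re]

/-- The Cauchy-Schwarz inequality for a positive functional and an accretive matrix
`[[D, 2 E], [0, W]]`, with an arbitrary weight. -/
lemma PositiveFunctional.two_mul_norm_le {f : (H →L[ℂ] H) →ₗ[ℂ] ℂ} (hf : PositiveFunctional f)
    {D E W : H →L[ℂ] H}
    (h : ∀ ζ ξ : H, 0 ≤ (inner ℂ ζ (D ζ) + 2 * inner ℂ ζ (E ξ) + inner ℂ ξ (W ξ)).re)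
    {t : ℝ} (ht : 0 < t) : 2 * ‖f E‖ ≤ t * (f D).re + t⁻¹ * (f W).re := by
  obtain ⟨u, hu, hue⟩ := exists_unit_mul_eq_neg_norm (f E)
  have := hf ((t : ℂ) • D + (2 * u) • E + ((t⁻¹ : ℝ) : ℂ) • W) fun ζ => by
    have hs : (0:ℝ) < √t := Real.sqrt_pos.2 ht
    have hs2 : ((√t : ℝ) : ℂ) * (√t : ℝ) = (t : ℝ) := by
      rw [← Complex.ofReal_mul, Real.mul_self_sqrt ht.le]
    have hne : ((√t : ℝ) : ℂ) ≠ 0 := by simpa using hs.ne'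
    have huu : star u * u = 1 := by
      have h := Complex.conj_mul' u
      rw [← Complex.star_def] at h
      rw [h, hu]; simp
    -- This substitution gives D and W the weights t and t⁻¹, while E keeps only the phase u, which
    -- turns f(E) into -‖f(E)‖.
    have h1 := h (((√t : ℝ) : ℂ) • ζ) ((u * ((√t : ℝ) : ℂ)⁻¹) • ζ)
    convert h1 using 2
    simp only [inner_smul_left, inner_smul_right, map_smul, inner_add_right,
      add_apply, smul_apply, map_mul, map_inv₀, Complex.conj_ofReal]
    rw [← Complex.star_def]
    have e1 : ((t⁻¹ : ℝ) : ℂ) = ((√t : ℝ) : ℂ)⁻¹ * ((√t : ℝ) : ℂ)⁻¹ := by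
      rw [← mul_inv, hs2, Complex.ofReal_inv]
    rw [e1, ← hs2]
    generalize ((√t : ℝ) : ℂ) = s at hne ⊢
    have e2 : s * (u * s⁻¹) = u := by field_simp
    linear_combination (-2 * inner ℂ ζ (E ζ)) * e2 - (s⁻¹ * s⁻¹ * inner ℂ ζ (W ζ)) * huu
  simp only [map_add, map_smul, smul_eq_mul, Complex.add_re, Complex.re_ofReal_mul, mul_assoc]
    at this
  rw [show (2 * (u * f E)).re = 2 * (u * f E).re by simp, hue] at this
  linarith

lemma re_inner_self (ζ : H) : (inner ℂ ζ ζ : ℂ).re = ‖ζ‖ ^ 2 := by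
  rw [inner_self_eq_norm_sq_to_K]
  norm_cast

lemma PositiveFunctional.re_one_nonneg {f : (H →L[ℂ] H) →ₗ[ℂ] ℂ} (hf : PositiveFunctional f) :
    0 ≤ (f 1).re :=
  hf 1 fun ζ => by
    rw [one_apply_eq_self, re_inner_self]
    positivity

lemma two_mul_re_inner_le (E : H →L[ℂ] H) (ζ ξ : H) :
    -(‖E‖ * (‖ζ‖ ^ 2 + ‖ξ‖ ^ 2)) ≤ 2 * (inner ℂ ζ (E ξ)).re := by
  have h1 : |(inner ℂ ζ (E ξ)).re| ≤ ‖ζ‖ * (‖E‖ * ‖ξ‖) :=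
    (Complex.abs_re_le_norm _).trans ((norm_inner_le_norm _ _).trans
      (by gcongr; exact E.le_opNorm ξ))
  have h2 := neg_le_of_abs_le h1
  nlinarith [mul_nonneg (norm_nonneg E) (sq_nonneg (‖ζ‖ - ‖ξ‖))]

lemma PositiveFunctional.norm_apply_le {f : (H →L[ℂ] H) →ₗ[ℂ] ℂ} (hf : PositiveFunctional f)
    (E : H →L[ℂ] H) : ‖f E‖ ≤ (f 1).re * ‖E‖ := by
  have := hf.two_mul_norm_le (D := (‖E‖ : ℂ) • 1) (E := E) (W := (‖E‖ : ℂ) • 1)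
    (fun ζ ξ => by
      have := two_mul_re_inner_le E ζ ξ
      simp [-inner_self_eq_norm_sq_to_K, re_inner_self]
      linarith) one_pos
  simp at this
  linarith

/-- The Schwarz inequality: the defect of multiplicativity of `θ` on `x w` is controlled by
its defect on `x x*`. -/
lemma PositiveFunctional.two_mul_norm_defect_le {X : Submodule ℂ (H →L[ℂ] H)} (hX : 1 ∈ X)
    {f : (H →L[ℂ] H) →ₗ[ℂ] ℂ} (hf : PositiveFunctional f)
    {θ : (H →L[ℂ] H) →ₗ[ℂ] (H →L[ℂ] H)} (hθ : θ ∈ fixingMaps X) {x : H →L[ℂ] H}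
    (hx : θ x = x) (w : H →L[ℂ] H) {t : ℝ} (ht : 0 < t) :
    2 * ‖f (θ (x * w) - x * θ w)‖ ≤
      t * (f (θ (x * star x) - x * star x)).re + t⁻¹ * (‖w‖ ^ 2 * (f 1).re) := by
  have hone : θ 1 = 1 := hθ.2 1 hX
  have := hf.two_mul_norm_le (D := θ (x * star x) - x * star x) (E := θ (x * w) - x * θ w)
    (W := ((‖w‖ ^ 2 : ℝ) : ℂ) • 1) (fun ζ ξ => by
      -- The real part of this form is ‖x*η₀ + η₁ + wη₂‖² + ‖w‖²‖η₂‖² - ‖wη₂‖² ≥ 0. After θ is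
      -- applied, the vector (ζ, -x*ζ, ξ) completes the square and leaves exactly the two defects
      -- and ‖w‖²‖ξ‖².
      have h := hθ.1 (Fin 3) ![![x * star x, (2 : ℂ) • x, (2 : ℂ) • (x * w)],
        ![0, 1, (2 : ℂ) • w], ![0, 0, ((‖w‖ ^ 2 : ℝ) : ℂ) • 1]] (fun η => by
          have e1 : (0:ℝ) ≤ ‖star x (η 0) + η 1 + w (η 2)‖ ^ 2 := by positivity
          have e2 : ‖w (η 2)‖ ^ 2 ≤ ‖w‖ ^ 2 * ‖η 2‖ ^ 2 := by
            rw [← mul_pow]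
            gcongr
            exact w.le_opNorm _
          rw [← re_inner_self, inner_add_left, inner_add_left] at e1
          rw [← re_inner_self (w _)] at e2
          have s1 : (inner ℂ (η 1) (star x (η 0)) : ℂ).re = (inner ℂ (star x (η 0)) (η 1) : ℂ).re :=
            inner_re_symm (𝕜 := ℂ) _ _
          have s2 : (inner ℂ (w (η 2)) (star x (η 0)) : ℂ).re =
            (inner ℂ (star x (η 0)) (w (η 2)) : ℂ).re := inner_re_symm (𝕜 := ℂ) _ _
          have s3 : (inner ℂ (w (η 2)) (η 1) : ℂ).re =
            (inner ℂ (η 1) (w (η 2)) : ℂ).re := inner_re_symm (𝕜 := ℂ) _ _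
          have a1 : ∀ ξ, inner ℂ (η 0) (x ξ) = inner ℂ (star x (η 0)) ξ := fun ξ => by
            rw [ContinuousLinearMap.star_eq_adjoint, ContinuousLinearMap.adjoint_inner_left]
          simp [-inner_self_eq_norm_sq_to_K, Fin.sum_univ_three, a1, re_inner_self,
            inner_add_right, -Complex.ofReal_pow] at e1 e2 ⊢
          nlinarith) ![ζ, -(star x ζ), ξ]
      have a1 : ∀ ξ, inner ℂ ζ (x ξ) = inner ℂ (star x ζ) ξ := fun ξ => by
        rw [ContinuousLinearMap.star_eq_adjoint, ContinuousLinearMap.adjoint_inner_left]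
      simp [-inner_self_eq_norm_sq_to_K, Fin.sum_univ_three, inner_smul_right, hx,
        hone, a1, re_inner_self, -Complex.ofReal_pow] at h ⊢
      linarith) ht
  simpa [-Complex.ofReal_pow] using this

end Accretive

/-! ### Extension of the projection along a boundary subsystem -/

section Extension

variable {H : Type*} [NormedAddCommGroup H] [InnerProductSpace ℂ H] [CompleteSpace H]

/-- In ‖ξ - tTξ‖² the cross term is nonpositive, so no first-order term in t remains. With its
converse below, this expresses accretivity by norms alone, which is how isometry becomes positivity.
-/
lemma norm_one_sub_smul_le {T : H →L[ℂ] H} (hT : ∀ ξ, 0 ≤ (inner ℂ ξ (T ξ)).re) {t : ℝ}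
    (ht : 0 ≤ t) : ‖1 - (t : ℂ) • T‖ ≤ 1 + t ^ 2 * ‖T‖ ^ 2 := by
  refine ContinuousLinearMap.opNorm_le_bound _ (by positivity) fun ξ => ?_
  refine abs_le_of_sq_le_sq' ?_ (by positivity) |>.2
  have h1 : ‖(1 - (t : ℂ) • T) ξ‖ ^ 2 =
      ‖ξ‖ ^ 2 - 2 * (t * (inner ℂ ξ (T ξ)).re) + t ^ 2 * ‖T ξ‖ ^ 2 := by
    rw [sub_apply, one_apply_eq_self, smul_apply, @norm_sub_sq ℂ, inner_smul_right, norm_smul,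
      mul_pow]
    simp
  have h2 : ‖T ξ‖ ^ 2 ≤ ‖T‖ ^ 2 * ‖ξ‖ ^ 2 := by
    rw [← mul_pow]
    gcongr
    exact T.le_opNorm ξ
  rw [h1, mul_pow]
  have h3 := mul_nonneg ht (hT ξ)
  have h4 : t ^ 2 * ‖T ξ‖ ^ 2 ≤ t ^ 2 * (‖T‖ ^ 2 * ‖ξ‖ ^ 2) := by gcongr
  have h5 : (1 + t ^ 2 * ‖T‖ ^ 2) * ‖ξ‖ ^ 2 ≤ (1 + t ^ 2 * ‖T‖ ^ 2) ^ 2 * ‖ξ‖ ^ 2 := by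
    gcongr
    nlinarith [mul_nonneg (sq_nonneg t) (sq_nonneg ‖T‖)]
  linarith

/-- The form of 1 - tS at ξ is at most (1 + t²C)‖ξ‖²; cancel ‖ξ‖², divide by t and let t tend to 0.
-/
lemma accretive_of_norm_one_sub_smul_le {S : H →L[ℂ] H} {C : ℝ}
    (h : ∀ t : ℝ, 0 < t → ‖1 - (t : ℂ) • S‖ ≤ 1 + t ^ 2 * C) (ξ : H) :
    0 ≤ (inner ℂ ξ (S ξ)).re := by
  have key : ∀ t : ℝ, 0 < t → -(inner ℂ ξ (S ξ)).re ≤ t * (C * ‖ξ‖ ^ 2) := fun t ht => by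
    have h1 : (inner ℂ ξ ((1 - (t : ℂ) • S) ξ)).re ≤ (1 + t ^ 2 * C) * ‖ξ‖ ^ 2 :=
      calc (inner ℂ ξ ((1 - (t : ℂ) • S) ξ)).re ≤ ‖ξ‖ * ‖(1 - (t : ℂ) • S) ξ‖ :=
            (Complex.re_le_norm _).trans (norm_inner_le_norm _ _)
        _ ≤ ‖ξ‖ * ((1 + t ^ 2 * C) * ‖ξ‖) := by
            gcongr
            exact ContinuousLinearMap.le_of_opNorm_le _ (h t ht) ξ
        _ = _ := by ring
    rw [sub_apply, one_apply_eq_self, smul_apply, inner_sub_right, inner_smul_right,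
      Complex.sub_re, re_inner_self, Complex.re_ofReal_mul] at h1
    have : t * (-(inner ℂ ξ (S ξ)).re) ≤ t * (t * (C * ‖ξ‖ ^ 2)) := by linarith
    exact le_of_mul_le_mul_left this ht
  have hlim : Filter.Tendsto (fun t : ℝ => t * (C * ‖ξ‖ ^ 2)) (nhdsWithin 0 (Set.Ioi 0))
      (nhds 0) := by
    have : Continuous fun t : ℝ => t * (C * ‖ξ‖ ^ 2) := by fun_prop
    simpa using (this.tendsto 0).mono_left nhdsWithin_le_nhds
  have := ge_of_tendsto hlim (Filter.eventually_of_mem self_mem_nhdsWithin key)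
  linarith

lemma IsBoundarySubsystem.matrixNorm_le {X S V : Submodule ℂ (H →L[ℂ] H)}
    (h : IsBoundarySubsystem X S V) {ν : ℕ} {x y : Matrix (Fin ν) (Fin ν) (H →L[ℂ] H)}
    (hx : ∀ i j, x i j ∈ X) (hy : ∀ i j, y i j ∈ V) : matrixNorm x ≤ matrixNorm (x + y) := by
  rw [← h.isometric ν x hx]
  exact ciInf_le ⟨0, by rintro _ ⟨y, rfl⟩; exact matrixNorm_nonneg _⟩
    (⟨y, hy⟩ : {y : Matrix (Fin ν) (Fin ν) (H →L[ℂ] H) // ∀ i j, y i j ∈ V})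

/-- For x in both, the choice y = -x gives ‖x‖ ≤ 0. Thus x + v ↦ x is well defined. -/
lemma IsBoundarySubsystem.disjoint {X S V : Submodule ℂ (H →L[ℂ] H)}
    (h : IsBoundarySubsystem X S V) : Disjoint X V := by
  rw [Submodule.disjoint_def]
  intro x hx hv
  let x' : Matrix (Fin 1) (Fin 1) (H →L[ℂ] H) := fun _ _ => x
  have h0 := h.matrixNorm_le (x := x') (y := -x') (fun _ _ => hx) (fun _ _ => V.neg_mem hv)
  rw [add_neg_cancel, matrixNorm_eq_norm_matrixAction, matrixNorm_eq_norm_matrixAction,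
    CStarMatrix.of_zero, map_zero, norm_zero] at h0
  have h2 := matrixAction_injective 1 ((norm_le_zero_iff.1 h0).trans (map_zero _).symm)
  exact congrFun (congrFun h2 0) 0

lemma matrixAction_one_sub_smul {ν : ℕ} (x : Matrix (Fin ν) (Fin ν) (H →L[ℂ] H)) (t : ℂ) :
    matrixAction H ν (CStarMatrix.ofMatrix (1 - t • x)) =
      1 - t • matrixAction H ν (CStarMatrix.ofMatrix x) := by
  rw [← CStarMatrix.of_sub_of, map_sub, ← CStarMatrix.smul_of, map_smul]
  congr 1
  ext ζ i
  rw [matrixAction_apply, Finset.sum_eq_single i]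
  · simp
  · intro j _ hj
    simp [Matrix.one_apply_ne hj.symm]
  · simp

/-- The projection `x + v ↦ x` along a boundary subsystem is completely positive. -/
lemma IsBoundarySubsystem.accretive {X S V : Submodule ℂ (H →L[ℂ] H)} (hX : 1 ∈ X)
    (h : IsBoundarySubsystem X S V) {ν : ℕ} {x y : Matrix (Fin ν) (Fin ν) (H →L[ℂ] H)}
    (hx : ∀ i j, x i j ∈ X) (hy : ∀ i j, y i j ∈ V)
    (ha : Accretive fun i j => x i j + y i j) : Accretive x := by
  have hT : ∀ ξ, 0 ≤ (inner ℂ ξ (matrixAction H ν (CStarMatrix.ofMatrix (x + y)) ξ)).re :=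
    fun ξ => by
      rw [inner_matrixAction]
      exact ha ξ
  intro ζ
  have := accretive_of_norm_one_sub_smul_le (S := matrixAction H ν (CStarMatrix.ofMatrix x))
    (C := ‖matrixAction H ν (CStarMatrix.ofMatrix (x + y))‖ ^ 2) (fun t ht => by
      rw [← matrixAction_one_sub_smul, ← matrixNorm_eq_norm_matrixAction]
      -- Since 1 ∈ X, the matrix 1 - tx has entries in X, and adding -ty gives 1 - t(x + y).
      refine (h.matrixNorm_le (y := -((t : ℂ) • y)) (fun i j => ?_) (fun i j => ?_)).trans ?_
      · refine X.sub_mem ?_ (X.smul_mem _ (hx i j))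
        rw [Matrix.one_apply]
        split_ifs
        exacts [hX, X.zero_mem]
      · exact V.neg_mem (V.smul_mem _ (hy i j))
      · rw [← sub_eq_add_neg, sub_sub, ← smul_add, matrixNorm_eq_norm_matrixAction,
          matrixAction_one_sub_smul]
        exact norm_one_sub_smul_le hT ht.le) (WithLp.toLp 2 ζ)
  rwa [inner_matrixAction] at this

/-- The functional `c ↦ ⟨η, c ξ⟩`. -/
def vectorFunctional (η ξ : H) : (H →L[ℂ] H) →ₗ[ℂ] ℂ :=
  (innerSL ℂ η).toLinearMap ∘ₗ (ContinuousLinearMap.apply ℂ H ξ).toLinearMap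

@[simp]
lemma vectorFunctional_apply (η ξ : H) (c : H →L[ℂ] H) :
    vectorFunctional η ξ c = inner ℂ η (c ξ) := rfl

/-- Evaluation of a formal sum of terms `η̄ ⊗ c ⊗ ξ` at a linear map `Z` of `H`, after
application of `φ` to the middle factors: the sum of the numbers `⟨Z η, φ(c) Z ξ⟩`. -/
def pairEval (φ : (H →L[ℂ] H) →ₗ[ℂ] (H →L[ℂ] H)) (Z : H →ₗ[ℂ] H) :
    ((H × H) →₀ (H →L[ℂ] H)) →ₗ[ℂ] ℂ :=
  Finsupp.lsum ℂ fun p => vectorFunctional (Z p.1) (Z p.2) ∘ₗ φ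

@[simp]
lemma pairEval_single (φ : (H →L[ℂ] H) →ₗ[ℂ] (H →L[ℂ] H)) (Z : H →ₗ[ℂ] H) (p : H × H)
    (c : H →L[ℂ] H) :
    pairEval φ Z (Finsupp.single p c) = inner ℂ (Z p.1) (φ c (Z p.2)) := by
  simp [pairEval]

/-- A formal sum of terms `η̄ ⊗ c ⊗ ξ` is equivalent to a matrix over an orthonormal family. -/
lemma exists_matrix_pairEval (a : (H × H) →₀ (H →L[ℂ] H)) :
    ∃ (ν : ℕ) (e : Fin ν → H) (A : Matrix (Fin ν) (Fin ν) (H →L[ℂ] H)), Orthonormal ℂ e ∧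
      (∀ W : Submodule ℂ (H →L[ℂ] H), (∀ p, a p ∈ W) → ∀ i j, A i j ∈ W) ∧
      ∀ φ Z, pairEval φ Z a = ∑ i, ∑ j, inner ℂ (Z (e i)) (φ (A i j) (Z (e j))) := by
  classical
  -- All vectors that occur are expanded in an orthonormal basis of their finite-dimensional span.
  let s : Finset H := a.support.image Prod.fst ∪ a.support.image Prod.snd
  let M : Submodule ℂ H := Submodule.span ℂ s
  let b := stdOrthonormalBasis ℂ M
  have hrepr : ∀ v ∈ M, v = ∑ i, inner ℂ (b i : H) v • (b i : H) := fun v hv => by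
    have := congrArg (Subtype.val) (b.sum_repr' ⟨v, hv⟩)
    simpa using this.symm
  have h1 : ∀ p ∈ a.support, p.1 ∈ M := fun p hp =>
    Submodule.subset_span (Finset.mem_union_left _ (Finset.mem_image_of_mem _ hp))
  have h2 : ∀ p ∈ a.support, p.2 ∈ M := fun p hp =>
    Submodule.subset_span (Finset.mem_union_right _ (Finset.mem_image_of_mem _ hp))
  refine ⟨_, fun i => b i, fun i j => ∑ p ∈ a.support,
    (star (inner ℂ (b i : H) p.1) * inner ℂ (b j : H) p.2) • a p, ?_, ?_, ?_⟩
  · exact b.orthonormal.comp_linearIsometry M.subtypeₗᵢ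
  · exact fun W hW i j => W.sum_mem fun p _ => W.smul_mem _ (hW p)
  · intro φ Z
    simp only [map_sum, sum_apply, inner_sum]
    rw [Finset.sum_congr rfl fun i _ => Finset.sum_comm, Finset.sum_comm]
    change a.sum _ = _
    refine Finset.sum_congr rfl fun p hp => ?_
    simp only [LinearMap.comp_apply, vectorFunctional_apply]
    conv_lhs => rw [hrepr _ (h1 p hp), hrepr _ (h2 p hp)]
    simp only [map_sum, map_smul, sum_inner, inner_sum, inner_smul_left, inner_smul_right,
      smul_apply, Finset.mul_sum]
    rw [Finset.sum_comm]
    refine Finset.sum_congr rfl fun i _ => Finset.sum_congr rfl fun j _ => ?_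
    rw [← Complex.star_def]
    ring

/-- The formal sums of terms `η̄ ⊗ c ⊗ ξ` all of whose evaluations are accretive. -/
def pairCone (H : Type*) [NormedAddCommGroup H] [InnerProductSpace ℂ H] :
    PointedCone ℝ ((H × H) →₀ (H →L[ℂ] H)) where
  carrier := {a | ∀ Z, 0 ≤ (pairEval LinearMap.id Z a).re}
  add_mem' ha hb Z := by
    rw [map_add, Complex.add_re]
    exact add_nonneg (ha Z) (hb Z)
  zero_mem' Z := by simp
  smul_mem' r a ha Z := by
    have : r • a = (((r : ℝ) : ℂ)) • a := by
      ext p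
      simp
    rw [this, map_smul, smul_eq_mul, Complex.re_ofReal_mul]
    exact mul_nonneg r.2 (ha Z)

lemma mul_re_inner_nonneg (c : H →L[ℂ] H) {u : ℂ} (hu : ‖u‖ = 1) (p q : ℝ) (hp : 0 ≤ p)
    (hq : 0 ≤ q) (η ξ : H) :
    0 ≤ ‖c‖ * q ^ 2 * ‖η‖ ^ 2 + 2 * (p * q) * (u * inner ℂ η (c ξ)).re
      + ‖c‖ * p ^ 2 * ‖ξ‖ ^ 2 := by
  have h1 : |(u * inner ℂ η (c ξ)).re| ≤ ‖η‖ * (‖c‖ * ‖ξ‖) := by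
    refine (Complex.abs_re_le_norm _).trans ?_
    rw [norm_mul, hu, one_mul]
    exact (norm_inner_le_norm _ _).trans (by gcongr; exact c.le_opNorm ξ)
  have h2 := mul_le_mul_of_nonneg_left (neg_le_of_abs_le h1) (mul_nonneg hp hq)
  nlinarith [mul_nonneg (norm_nonneg c) (sq_nonneg (q * ‖η‖ - p * ‖ξ‖))]

/-- The cofinality hypothesis of the Riesz extension theorem: η̄ ⊗ c ⊗ ξ enters the cone once ‖c‖(η̄
⊗ 1 ⊗ η + ξ̄ ⊗ 1 ⊗ ξ) is added. -/
lemma exists_add_mem_pairCone {W : Submodule ℂ (H →L[ℂ] H)} (hW : 1 ∈ W)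
    (y : (H × H) →₀ (H →L[ℂ] H)) :
    ∃ x : (H × H) →₀ (H →L[ℂ] H), (∀ p, x p ∈ W) ∧ x + y ∈ pairCone H := by
  classical
  induction y using Finsupp.induction_linear with
  | zero => exact ⟨0, fun _ => W.zero_mem, by simp⟩
  | add y z hy hz =>
    obtain ⟨a, ha, hay⟩ := hy
    obtain ⟨b, hb, hbz⟩ := hz
    refine ⟨a + b, fun p => W.add_mem (ha p) (hb p), ?_⟩
    rw [add_add_add_comm]
    exact add_mem hay hbz
  | single p c =>
    refine ⟨Finsupp.single (p.1, p.1) ((‖c‖ : ℂ) • 1) + Finsupp.single (p.2, p.2) ((‖c‖ : ℂ) • 1),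
      fun q => ?_, fun Z => ?_⟩
    · rw [Finsupp.add_apply, Finsupp.single_apply, Finsupp.single_apply]
      refine W.add_mem ?_ ?_ <;> split_ifs
      all_goals first | exact W.smul_mem _ hW | exact W.zero_mem
    · have h1 := two_mul_re_inner_le c (Z p.1) (Z p.2)
      simp [-inner_self_eq_norm_sq_to_K, re_inner_self]
      nlinarith [mul_nonneg (norm_nonneg c) (sq_nonneg ‖Z p.1‖),
        mul_nonneg (norm_nonneg c) (sq_nonneg ‖Z p.2‖)]

/-- The projection `x + v ↦ x` along a boundary subsystem induces a positive functional on formal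
sums with coefficients in `X ⊔ V`. -/
lemma IsBoundarySubsystem.pairEval_nonneg {X S V : Submodule ℂ (H →L[ℂ] H)} (hX : 1 ∈ X)
    (h : IsBoundarySubsystem X S V) {φ : (H →L[ℂ] H) →ₗ[ℂ] (H →L[ℂ] H)}
    (hφX : ∀ x ∈ X, φ x = x) (hφV : ∀ v ∈ V, φ v = 0) {a : (H × H) →₀ (H →L[ℂ] H)}
    (ha : ∀ p, a p ∈ X ⊔ V) (hpos : a ∈ pairCone H) : 0 ≤ (pairEval φ LinearMap.id a).re := by
  obtain ⟨ν, e, A, he, hA, heval⟩ := exists_matrix_pairEval a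
  have hsplit : ∀ w ∈ X ⊔ V, φ w ∈ X ∧ w - φ w ∈ V := fun w hw => by
    obtain ⟨x, hx, v, hv, rfl⟩ := Submodule.mem_sup.1 hw
    rw [map_add, hφX x hx, hφV v hv, add_zero, add_sub_cancel_left]
    exact ⟨hx, hv⟩
  have hmem := hA _ ha
  have := h.accretive hX (x := fun i j => φ (A i j)) (y := fun i j => A i j - φ (A i j))
    (fun i j => (hsplit _ (hmem i j)).1) (fun i j => (hsplit _ (hmem i j)).2) (fun ζ => by
      -- By orthonormality Z sends e_j to the arbitrary vector ζ_j, so membership in the cone is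
      -- accretivity of the whole matrix A.
      let Z : H →ₗ[ℂ] H := ∑ i, (innerSL ℂ (e i)).toLinearMap.smulRight (ζ i)
      have hZ : ∀ j, Z (e j) = ζ j := fun j => by
        have : ∀ i, (inner ℂ (e i) (e j) : ℂ) • ζ i = if i = j then ζ i else 0 := fun i => by
          rw [orthonormal_iff_ite.1 he i j]
          split_ifs <;> simp
        simp [Z, this]
      have := hpos Z
      rw [heval] at this
      simpa [hZ] using this) e
  rw [heval]
  exact this

/-- The real part of the functional is extended by M. Riesz's theorem and then complexified. -/
lemma IsBoundarySubsystem.exists_pairFunctional {X S V : Submodule ℂ (H →L[ℂ] H)} (hX : 1 ∈ X)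
    (h : IsBoundarySubsystem X S V) {φ : (H →L[ℂ] H) →ₗ[ℂ] (H →L[ℂ] H)}
    (hφX : ∀ x ∈ X, φ x = x) (hφV : ∀ v ∈ V, φ v = 0) :
    ∃ G : ((H × H) →₀ (H →L[ℂ] H)) →ₗ[ℂ] ℂ, (∀ a ∈ pairCone H, 0 ≤ (G a).re) ∧
      ∀ a : (H × H) →₀ (H →L[ℂ] H), (∀ p, a p ∈ X ⊔ V) → G a = pairEval φ LinearMap.id a := by
  let D : Submodule ℂ ((H × H) →₀ (H →L[ℂ] H)) :=
    { carrier := {a | ∀ p, a p ∈ X ⊔ V}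
      add_mem' := fun ha hb p => (X ⊔ V).add_mem (ha p) (hb p)
      zero_mem' := fun _ => (X ⊔ V).zero_mem
      smul_mem' := fun c _ ha p => (X ⊔ V).smul_mem c (ha p) }
  let f : ((H × H) →₀ (H →L[ℂ] H)) →ₗ.[ℝ] ℝ :=
    ⟨D.restrictScalars ℝ, (Complex.reLm ∘ₗ
      (pairEval φ LinearMap.id).restrictScalars ℝ).domRestrict _⟩
  obtain ⟨g, hgf, hg⟩ := riesz_extension (pairCone H) f
    (fun x hx => h.pairEval_nonneg hX hφX hφV x.2 hx) (fun y => by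
      obtain ⟨x, hx, hxy⟩ := exists_add_mem_pairCone (W := X ⊔ V) (Submodule.mem_sup_left hX) y
      exact ⟨⟨x, hx⟩, hxy⟩)
  have hgD : ∀ a ∈ D, g a = (pairEval φ LinearMap.id a).re := fun a ha => hgf ⟨a, ha⟩
  refine ⟨Module.Dual.extendRCLike g, fun a ha => ?_, fun a ha => ?_⟩
  · exact (hg a ha).trans_eq (Module.Dual.re_extendRCLike_apply (𝕜 := ℂ) g a).symm
  · apply Complex.ext
    · exact (Module.Dual.re_extendRCLike_apply (𝕜 := ℂ) g a).trans (hgD a ha)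
    · refine (Module.Dual.im_extendRCLike_apply (𝕜 := ℂ) g a).trans ?_
      rw [hgD _ (D.smul_mem _ ha), map_smul]
      simp

lemma exists_operator_of_form (S : H →ₗ⋆[ℂ] H →ₗ[ℂ] ℂ) (C : ℝ)
    (hC : ∀ η ξ, ‖S η ξ‖ ≤ C * ‖η‖ * ‖ξ‖) :
    ∃ T : H →L[ℂ] H, ∀ η ξ, inner ℂ η (T ξ) = S η ξ := by
  refine ⟨ContinuousLinearMap.adjoint
    (InnerProductSpace.continuousLinearMapOfBilin (S.mkContinuous₂ C hC)), fun η ξ => ?_⟩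
  rw [ContinuousLinearMap.adjoint_inner_right,
    InnerProductSpace.continuousLinearMapOfBilin_apply]
  rfl

/-- Arveson's extension theorem for the projection `x + v ↦ x` along a boundary subsystem. -/
theorem IsBoundarySubsystem.exists_fixingMap {X S V : Submodule ℂ (H →L[ℂ] H)} (hX : 1 ∈ X)
    (h : IsBoundarySubsystem X S V) : ∃ ψ ∈ fixingMaps X, ∀ v ∈ V, ψ v = 0 := by
  obtain ⟨φ, hφX, hφV⟩ : ∃ φ : (H →L[ℂ] H) →ₗ[ℂ] (H →L[ℂ] H),
      (∀ x ∈ X, φ x = x) ∧ ∀ v ∈ V, φ v = 0 := by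
    -- Any algebraic complement of X containing V will do: only the values of φ on X + V are used.
    obtain ⟨W, hVW, hW⟩ := h.disjoint.symm.exists_isCompl
    refine ⟨X.subtype ∘ₗ Submodule.projectionOnto X W hW.symm, fun x hx => ?_,
      fun v hv => ?_⟩
    · exact congrArg Subtype.val (Submodule.projectionOnto_apply_left hW.symm ⟨x, hx⟩)
    · exact congrArg Subtype.val
        (Submodule.projectionOnto_apply_right hW.symm ⟨v, hVW hv⟩)
  obtain ⟨G, hpos, hG⟩ := h.exists_pairFunctional hX hφX hφV
  -- Such a satisfy ±a, ±ia ∈ `pairCone H`. Hence G respects the tensor relations, which makes each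
  -- F c below sesquilinear.
  have hzero : ∀ a, (∀ Z, pairEval LinearMap.id Z a = 0) → G a = 0 := fun a ha => by
    have key : ∀ b, (∀ Z, pairEval LinearMap.id Z b = 0) → (G b).re = 0 := fun b hb => by
      have h1 := hpos b fun Z => by rw [hb Z]; simp
      have h2 := hpos (-b) fun Z => by rw [map_neg, hb Z]; simp
      rw [map_neg, Complex.neg_re] at h2
      linarith
    have h2 := key (Complex.I • a) fun Z => by rw [map_smul, ha Z, smul_zero]
    apply Complex.ext
    · exact key a ha
    · simpa using h2
  have hsingle : ∀ η ξ, ∀ w ∈ X ⊔ V, G (Finsupp.single (η, ξ) w) = inner ℂ η (φ w ξ) :=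
    fun η ξ w hw => by
      classical
      rw [hG _ fun p => ?_]
      · simp
      · rw [Finsupp.single_apply]
        split_ifs
        exacts [hw, Submodule.zero_mem _]
  let F : (H →L[ℂ] H) → H →ₗ⋆[ℂ] H →ₗ[ℂ] ℂ := fun c =>
    LinearMap.mk₂'ₛₗ (starRingEnd ℂ) (RingHom.id ℂ) (fun η ξ => G (Finsupp.single (η, ξ) c))
      (fun η η' ξ => by
        rw [← sub_eq_zero, ← map_add, ← map_sub]
        exact hzero _ fun Z => by simp)
      (fun r η ξ => by
        rw [← sub_eq_zero, ← map_smul, ← map_sub]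
        exact hzero _ fun Z => by simp [mul_comm])
      (fun η ξ ξ' => by
        rw [← sub_eq_zero, ← map_add, ← map_sub]
        exact hzero _ fun Z => by simp)
      (fun r η ξ => by
        rw [← sub_eq_zero, ← map_smul, ← map_sub]
        exact hzero _ fun Z => by simp)
  have hbound : ∀ c η ξ, ‖F c η ξ‖ ≤ ‖c‖ * ‖η‖ * ‖ξ‖ := fun c η ξ => by
    by_cases hη : η = 0
    · simp [hη]
    by_cases hξ : ξ = 0
    · simp [hξ]
    change ‖G (Finsupp.single (η, ξ) c)‖ ≤ _
    obtain ⟨u, hu, hue⟩ := exists_unit_mul_eq_neg_norm (G (Finsupp.single (η, ξ) c))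
    have h1X : (1 : H →L[ℂ] H) ∈ X ⊔ V := Submodule.mem_sup_left hX
    -- The crossed weights ‖ξ‖² and ‖η‖² make the two outer terms equal under G, which gives the
    -- sharp constant ‖c‖.
    have := hpos (((‖c‖ * ‖ξ‖ ^ 2 : ℝ) : ℂ) • Finsupp.single (η, η) 1
      + ((2 * (‖η‖ * ‖ξ‖) : ℝ) : ℂ) • u • Finsupp.single (η, ξ) c
      + ((‖c‖ * ‖η‖ ^ 2 : ℝ) : ℂ) • Finsupp.single (ξ, ξ) 1) fun Z => by
        have := mul_re_inner_nonneg c hu ‖η‖ ‖ξ‖ (norm_nonneg _) (norm_nonneg _) (Z η) (Z ξ)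
        simpa only [map_add, map_smul, pairEval_single, LinearMap.id_apply, one_apply_eq_self,
          smul_eq_mul, Complex.add_re, Complex.re_ofReal_mul, re_inner_self] using this
    simp only [map_add, map_smul, hsingle _ _ _ h1X, hφX 1 hX, one_apply_eq_self,
      smul_eq_mul, Complex.add_re, Complex.re_ofReal_mul, re_inner_self, hue] at this
    have hpp : 0 < ‖η‖ * ‖ξ‖ := mul_pos (norm_pos_iff.2 hη) (norm_pos_iff.2 hξ)
    refine le_of_mul_le_mul_left ?_ hpp
    linarith
  choose T hT using fun c => exists_operator_of_form (F c) ‖c‖ (hbound c)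
  have hT' : ∀ c η ξ, inner ℂ η (T c ξ) = G (Finsupp.single (η, ξ) c) := hT
  let ψ : (H →L[ℂ] H) →ₗ[ℂ] (H →L[ℂ] H) :=
    { toFun := T
      map_add' := fun c d => by
        ext ξ
        refine ext_inner_left ℂ fun η => ?_
        rw [add_apply, inner_add_right, hT', hT', hT', Finsupp.single_add, map_add]
      map_smul' := fun r c => by
        ext ξ
        refine ext_inner_left ℂ fun η => ?_
        rw [RingHom.id_apply, smul_apply, inner_smul_right, hT', hT', ← Finsupp.smul_single,
          map_smul, smul_eq_mul] }
  have hψ : ∀ w ∈ X ⊔ V, ψ w = φ w := fun w hw => by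
    ext ξ
    refine ext_inner_left ℂ fun η => ?_
    exact (hT' w η ξ).trans (hsingle η ξ w hw)
  refine ⟨ψ, ⟨fun ι _ A hA ζ => ?_, fun x hx => ?_⟩, fun v hv => ?_⟩
  · have := hpos (∑ i, ∑ j, Finsupp.single (ζ i, ζ j) (A i j)) fun Z => by
      simpa using hA fun i => Z (ζ i)
    simp only [map_sum, ← hT'] at this
    exact this
  · rw [hψ x (Submodule.mem_sup_left hx), hφX x hx]
  · rw [hψ v (Submodule.mem_sup_right hv), hφV v hv]

end Extension

/-! ### Asymptotics along the semigroup of maps fixing X -/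

section Vanishing

variable {H : Type*} [NormedAddCommGroup H] [InnerProductSpace ℂ H] [CompleteSpace H]

/-- The linear span of the positive functionals. -/
def positiveSpan (H : Type*) [NormedAddCommGroup H] [InnerProductSpace ℂ H] :
    Submodule ℂ ((H →L[ℂ] H) →ₗ[ℂ] ℂ) :=
  Submodule.span ℂ {f | PositiveFunctional f}

lemma PositiveFunctional.conj {f : (H →L[ℂ] H) →ₗ[ℂ] ℂ} (hf : PositiveFunctional f)
    (d : H →L[ℂ] H) :
    PositiveFunctional (f ∘ₗ LinearMap.mulLeft ℂ (star d) ∘ₗ LinearMap.mulRight ℂ d) := by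
  intro c hc
  refine hf (star d * (c * d)) fun ζ => ?_
  have h1 : inner ℂ ζ ((star d * (c * d)) ζ) = inner ℂ (d ζ) (c (d ζ)) := by
    rw [ContinuousLinearMap.star_eq_adjoint]
    exact ContinuousLinearMap.adjoint_inner_right d ζ (c (d ζ))
  rw [h1]
  exact hc (d ζ)

/-- Polarisation of c ↦ f(d*cd) over d = a* + u with u⁴ = 1. -/
lemma mul_left_mem_positiveSpan {f : (H →L[ℂ] H) →ₗ[ℂ] ℂ} (hf : PositiveFunctional f)
    (a : H →L[ℂ] H) : f ∘ₗ LinearMap.mulLeft ℂ a ∈ positiveSpan H := by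
  let g : ℂ → (H →L[ℂ] H) →ₗ[ℂ] ℂ := fun u =>
    f ∘ₗ LinearMap.mulLeft ℂ (star (star a + u • 1)) ∘ₗ LinearMap.mulRight ℂ (star a + u • 1)
  have hg : ∀ u, g u ∈ positiveSpan H := fun u => Submodule.subset_span (hf.conj _)
  have : f ∘ₗ LinearMap.mulLeft ℂ a = (4⁻¹ : ℂ) •
      (g 1 - g (-1) - Complex.I • g Complex.I + Complex.I • g (-Complex.I)) := by
    ext c
    simp [g, add_mul, mul_add, sub_eq_add_neg]
    ring_nf
    simp
    ring
  rw [this]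
  exact Submodule.smul_mem _ _ (Submodule.add_mem _ (Submodule.sub_mem _ (Submodule.sub_mem _
    (hg _) (hg _)) (Submodule.smul_mem _ _ (hg _))) (Submodule.smul_mem _ _ (hg _)))

lemma vectorFunctional_mem_positiveSpan (η ξ : H) : vectorFunctional η ξ ∈ positiveSpan H := by
  let g : ℂ → (H →L[ℂ] H) →ₗ[ℂ] ℂ := fun u => vectorFunctional (η + u • ξ) (η + u • ξ)
  have hg : ∀ u, g u ∈ positiveSpan H := fun u => Submodule.subset_span fun c hc => hc _
  have : vectorFunctional η ξ = (4⁻¹ : ℂ) •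
      (g 1 - g (-1) - Complex.I • g Complex.I + Complex.I • g (-Complex.I)) := by
    ext c
    simp [g, inner_add_left, inner_smul_left, inner_smul_right]
    ring_nf
    simp
    ring
  rw [this]
  exact Submodule.smul_mem _ _ (Submodule.add_mem _ (Submodule.sub_mem _ (Submodule.sub_mem _
    (hg _) (hg _)) (Submodule.smul_mem _ _ (hg _))) (Submodule.smul_mem _ _ (hg _)))

/-- The asymptotic vanishing of `θ c - s θ' c` along the semigroup of completely positive maps
that fix `X`. For `s = 0` this says that `c` is asymptotically annihilated by the semigroup, for
`s = 1` that the images of `c` converge. -/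
def Vanishes (X : Submodule ℂ (H →L[ℂ] H)) (s : ℝ) (c : H →L[ℂ] H) : Prop :=
  ∀ f, PositiveFunctional f → ∀ ε > 0, ∃ θ₀ ∈ fixingMaps X, ∀ θ ∈ fixingMaps X,
    ∀ θ' ∈ fixingMaps X, ‖f (θ₀ (θ c - (s : ℂ) • θ' c))‖ ≤ ε

variable {X : Submodule ℂ (H →L[ℂ] H)} {s : ℝ}

lemma Vanishes.zero : Vanishes X s 0 := fun _ _ _ hε =>
  ⟨LinearMap.id, id_mem_fixingMaps X, fun _ _ _ _ => by simpa using hε.le⟩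

/-- An estimate for θ₁ holds for all θ, so it persists for θ₁θ₂; choosing θ₂ for the positive
functional f ∘ θ₁ secures both estimates. -/
lemma Vanishes.add {c d : H →L[ℂ] H} (hc : Vanishes X s c) (hd : Vanishes X s d) :
    Vanishes X s (c + d) := fun f hf ε hε => by
  obtain ⟨θ₁, h1, hc⟩ := hc f hf (ε / 2) (half_pos hε)
  obtain ⟨θ₂, h2, hd⟩ := hd (f ∘ₗ θ₁) (hf.comp h1.1) (ε / 2) (half_pos hε)
  refine ⟨θ₁ ∘ₗ θ₂, comp_mem_fixingMaps h1 h2, fun θ hθ θ' hθ' => ?_⟩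
  have e1 := hc (θ₂ ∘ₗ θ) (comp_mem_fixingMaps h2 hθ) (θ₂ ∘ₗ θ') (comp_mem_fixingMaps h2 hθ')
  have e2 := hd θ hθ θ' hθ'
  simp only [LinearMap.comp_apply, ← map_smul, ← map_sub] at e1 e2 ⊢
  have : θ (c + d) - (s : ℂ) • θ' (c + d) =
      (θ c - (s : ℂ) • θ' c) + (θ d - (s : ℂ) • θ' d) := by
    rw [map_add, map_add, smul_add]
    abel
  simp only [← map_smul] at this
  rw [this, map_add, map_add, map_add]
  exact (norm_add_le _ _).trans (by linarith)

lemma Vanishes.smul {c : H →L[ℂ] H} (hc : Vanishes X s c) (r : ℂ) :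
    Vanishes X s (r • c) := fun f hf ε hε => by
  obtain ⟨θ₁, h1, hc⟩ := hc f hf (ε / (‖r‖ + 1)) (by positivity)
  refine ⟨θ₁, h1, fun θ hθ θ' hθ' => ?_⟩
  have e1 := hc θ hθ θ' hθ'
  rw [map_smul, map_smul, smul_comm (s : ℂ) r, ← smul_sub, map_smul, map_smul, norm_smul]
  calc _ ≤ ‖r‖ * (ε / (‖r‖ + 1)) := by gcongr
    _ = ε * (‖r‖ / (‖r‖ + 1)) := by ring
    _ ≤ ε * 1 := by
      gcongr
      rw [div_le_one (by positivity)]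
      linarith
    _ = ε := mul_one ε

lemma Vanishes.star {c : H →L[ℂ] H} (hc : Vanishes X s c) : Vanishes X s (star c) :=
  fun f hf ε hε => by
    obtain ⟨θ₁, h1, hc⟩ := hc f hf ε hε
    refine ⟨θ₁, h1, fun θ hθ θ' hθ' => ?_⟩
    have : θ (Star.star c) - (s : ℂ) • θ' (Star.star c) = Star.star (θ c - (s : ℂ) • θ' c) := by
      rw [star_sub, star_smul, hθ.1.map_star, hθ'.1.map_star]
      simp
    rw [this, h1.1.map_star, hf.map_star, norm_star]
    exact hc θ hθ θ' hθ'

lemma norm_apply_fixingMap_le (hX : 1 ∈ X) {f : (H →L[ℂ] H) →ₗ[ℂ] ℂ}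
    (hf : PositiveFunctional f) {θ : (H →L[ℂ] H) →ₗ[ℂ] (H →L[ℂ] H)} (hθ : θ ∈ fixingMaps X)
    (c : H →L[ℂ] H) : ‖f (θ c)‖ ≤ (f 1).re * ‖c‖ := by
  have := (hf.comp hθ.1).norm_apply_le c
  rwa [LinearMap.comp_apply, LinearMap.comp_apply, hθ.2 1 hX] at this

/-- The functionals f ∘ θ are bounded by f(1), uniformly over the semigroup. -/
lemma isClosed_vanishes (hX : 1 ∈ X) : IsClosed {c : H →L[ℂ] H | Vanishes X s c} := by
  refine isClosed_of_closure_subset fun c hc f hf ε hε => ?_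
  have hf1 := hf.re_one_nonneg
  set K := (1 + |s|) * ((f 1).re + 1) with hK
  have hKpos : 0 < K := by positivity
  obtain ⟨d, hd, hcd⟩ := Metric.mem_closure_iff.1 hc (ε / 2 / K) (by positivity)
  obtain ⟨θ₁, h1, hd⟩ := hd f hf (ε / 2) (half_pos hε)
  refine ⟨θ₁, h1, fun θ hθ θ' hθ' => ?_⟩
  have e1 := hd θ hθ θ' hθ'
  have e2 := norm_apply_fixingMap_le hX hf (comp_mem_fixingMaps h1 hθ) (c - d)
  have e3 := norm_apply_fixingMap_le hX hf (comp_mem_fixingMaps h1 hθ') (c - d)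
  have e4 : f (θ₁ (θ c - (s : ℂ) • θ' c)) = f (θ₁ (θ d - (s : ℂ) • θ' d)) +
      (f ((θ₁ ∘ₗ θ) (c - d)) - s * f ((θ₁ ∘ₗ θ') (c - d))) := by
    simp only [LinearMap.comp_apply, map_sub, map_smul, smul_eq_mul]
    ring
  have e5 : ‖c - d‖ ≤ ε / 2 / K := by rw [← dist_eq_norm]; exact hcd.le
  have e6 : ‖(s : ℂ) * f ((θ₁ ∘ₗ θ') (c - d))‖ ≤ |s| * ((f 1).re * ‖c - d‖) := by
    rw [norm_mul, Complex.norm_real, Real.norm_eq_abs]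
    gcongr
  have e7 : K * ‖c - d‖ ≤ ε / 2 := by
    rwa [le_div_iff₀' hKpos] at e5
  rw [e4]
  have e8 : (1 + |s|) * ((f 1).re * ‖c - d‖) ≤ K * ‖c - d‖ := by
    rw [hK, mul_assoc]
    gcongr
    linarith
  have := (norm_add_le (f (θ₁ (θ d - (s : ℂ) • θ' d)))
    (f ((θ₁ ∘ₗ θ) (c - d)) - s * f ((θ₁ ∘ₗ θ') (c - d)))).trans
    (add_le_add_right (norm_sub_le _ _) _)
  linarith

/-- The extra map σ is there for the induction: a second summand must be handled after the map found
for the first. -/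
lemma Vanishes.exists_of_mem_positiveSpan {c : H →L[ℂ] H} (hc : Vanishes X s c)
    {h : (H →L[ℂ] H) →ₗ[ℂ] ℂ} (hh : h ∈ positiveSpan H) :
    ∀ σ ∈ fixingMaps X, ∀ ε > 0, ∃ θ₀ ∈ fixingMaps X, ∀ θ ∈ fixingMaps X,
      ∀ θ' ∈ fixingMaps X, ‖h (σ (θ₀ (θ c - (s : ℂ) • θ' c)))‖ ≤ ε := by
  induction hh using Submodule.span_induction with
  | mem f hf => exact fun σ hσ ε hε => hc (f ∘ₗ σ) (hf.comp hσ.1) ε hε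
  | zero => exact fun _ _ _ hε =>
      ⟨LinearMap.id, id_mem_fixingMaps X, fun _ _ _ _ => by simpa using hε.le⟩
  | add f g _ _ hf hg =>
    intro σ hσ ε hε
    obtain ⟨θ₁, h1, hf⟩ := hf σ hσ (ε / 2) (half_pos hε)
    obtain ⟨θ₂, h2, hg⟩ := hg (σ ∘ₗ θ₁) (comp_mem_fixingMaps hσ h1) (ε / 2) (half_pos hε)
    refine ⟨θ₁ ∘ₗ θ₂, comp_mem_fixingMaps h1 h2, fun θ hθ θ' hθ' => ?_⟩
    have e1 := hf (θ₂ ∘ₗ θ) (comp_mem_fixingMaps h2 hθ) (θ₂ ∘ₗ θ') (comp_mem_fixingMaps h2 hθ')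
    have e2 := hg θ hθ θ' hθ'
    simp only [LinearMap.comp_apply, ← map_smul, ← map_sub] at e1 e2 ⊢
    exact (norm_add_le _ _).trans (by linarith)
  | smul r f _ hf =>
    intro σ hσ ε hε
    obtain ⟨θ₁, h1, hf⟩ := hf σ hσ (ε / (‖r‖ + 1)) (by positivity)
    refine ⟨θ₁, h1, fun θ hθ θ' hθ' => ?_⟩
    rw [LinearMap.smul_apply, norm_smul]
    calc _ ≤ ‖r‖ * (ε / (‖r‖ + 1)) := by gcongr; exact hf θ hθ θ' hθ'
      _ = ε * (‖r‖ / (‖r‖ + 1)) := by ring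
      _ ≤ ε * 1 := by
        gcongr
        rw [div_le_one (by positivity)]
        linarith
      _ = ε := mul_one ε

lemma exists_norm_sum_le {κ : Type*} (t : Finset κ) {h : κ → (H →L[ℂ] H) →ₗ[ℂ] ℂ}
    {c : κ → H →L[ℂ] H} (hh : ∀ k, h k ∈ positiveSpan H) (hc : ∀ k, Vanishes X s (c k)) :
    ∀ σ ∈ fixingMaps X, ∀ ε > 0, ∃ θ₀ ∈ fixingMaps X, ∀ θ ∈ fixingMaps X,
      ∀ θ' ∈ fixingMaps X, ‖∑ k ∈ t, h k (σ (θ₀ (θ (c k) - (s : ℂ) • θ' (c k))))‖ ≤ ε := by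
  classical
  induction t using Finset.induction_on with
  | empty => exact fun _ _ _ hε =>
      ⟨LinearMap.id, id_mem_fixingMaps X, fun _ _ _ _ => by simpa using hε.le⟩
  | insert k t hk ih =>
    intro σ hσ ε hε
    obtain ⟨θ₁, h1, hf⟩ := (hc k).exists_of_mem_positiveSpan (hh k) σ hσ (ε / 2) (half_pos hε)
    obtain ⟨θ₂, h2, hg⟩ := ih (σ ∘ₗ θ₁) (comp_mem_fixingMaps hσ h1) (ε / 2) (half_pos hε)
    refine ⟨θ₁ ∘ₗ θ₂, comp_mem_fixingMaps h1 h2, fun θ hθ θ' hθ' => ?_⟩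
    have e1 := hf (θ₂ ∘ₗ θ) (comp_mem_fixingMaps h2 hθ) (θ₂ ∘ₗ θ') (comp_mem_fixingMaps h2 hθ')
    have e2 := hg θ hθ θ' hθ'
    rw [Finset.sum_insert hk]
    simp only [LinearMap.comp_apply, ← map_smul, ← map_sub] at e1 e2 ⊢
    exact (norm_add_le _ _).trans (by linarith)

/-- Along the semigroup of completely positive maps that fix `X`, the elements of `X` and their
adjoints are asymptotically in the multiplicative domain. -/
lemma exists_norm_defect_le (hX : 1 ∈ X) {f : (H →L[ℂ] H) →ₗ[ℂ] ℂ}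
    (hf : PositiveFunctional f) {x : H →L[ℂ] H} (hx : ∀ θ ∈ fixingMaps X, θ x = x)
    (w : H →L[ℂ] H) {ε : ℝ} (hε : 0 < ε) :
    ∃ θ₁ ∈ fixingMaps X, ∀ θ ∈ fixingMaps X, ‖f (θ₁ (θ (x * w) - x * θ w))‖ ≤ ε := by
  have hf1 := hf.re_one_nonneg
  set M := ‖w‖ ^ 2 * (f 1).re + 1 with hM
  have hMpos : 0 < M := by positivity
  let A : Set ℝ := (fun θ : (H →L[ℂ] H) →ₗ[ℂ] (H →L[ℂ] H) => (f (θ (x * star x))).re) ''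
    fixingMaps X
  have hA : BddAbove A := by
    refine ⟨(f 1).re * ‖x * star x‖, ?_⟩
    rintro _ ⟨θ, hθ, rfl⟩
    exact (Complex.re_le_norm _).trans (norm_apply_fixingMap_le hX hf hθ _)
  have hA0 : A.Nonempty := ⟨_, LinearMap.id, id_mem_fixingMaps X, rfl⟩
  -- The tolerance is ε²/M, so that the weight t = M/ε makes each of the two Schwarz terms at most
  -- ε.
  obtain ⟨_, ⟨θ₁, h1, rfl⟩, hlt⟩ := exists_lt_of_lt_csSup hA0
    (show sSup A - ε / (M / ε) < sSup A by
      have : 0 < ε / (M / ε) := by positivity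
      linarith)
  refine ⟨θ₁, h1, fun θ hθ => ?_⟩
  have e1 := (hf.comp h1.1).two_mul_norm_defect_le hX hθ (hx θ hθ) w
    (t := M / ε) (by positivity)
  have e2 : (f (θ₁ (θ (x * star x)))).re ≤ sSup A :=
    le_csSup hA ⟨θ₁ ∘ₗ θ, comp_mem_fixingMaps h1 hθ, rfl⟩
  simp only [LinearMap.comp_apply, h1.2 1 hX] at e1
  have e3 : (f (θ₁ (θ (x * star x) - x * star x))).re ≤ ε / (M / ε) := by
    rw [map_sub, map_sub, Complex.sub_re]
    linarith
  have e4 : M / ε * (f (θ₁ (θ (x * star x) - x * star x))).re ≤ ε := by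
    calc _ ≤ M / ε * (ε / (M / ε)) := by gcongr
      _ = ε := by field_simp
  have e5 : (M / ε)⁻¹ * (‖w‖ ^ 2 * (f 1).re) ≤ ε := by
    calc _ ≤ (M / ε)⁻¹ * M := by gcongr; linarith
      _ = ε := by field_simp
  linarith

/-- Under f ∘ θ₁, θ(xw) may be replaced by xθ(w). The functional c ↦ f(θ₁(xc)) is a combination of
positive ones, so it is controlled by the hypothesis on w. -/
lemma Vanishes.mul_left (hX : 1 ∈ X) {x w : H →L[ℂ] H}
    (hx : ∀ θ ∈ fixingMaps X, θ x = x) (hw : Vanishes X s w) : Vanishes X s (x * w) :=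
  fun f hf ε hε => by
    obtain ⟨θ₁, h1, hdef⟩ := exists_norm_defect_le hX hf hx w
      (ε := ε / 2 / (1 + |s|)) (by positivity)
    obtain ⟨θ₂, h2, hsm⟩ := hw.exists_of_mem_positiveSpan
      (mul_left_mem_positiveSpan (hf.comp h1.1) x) LinearMap.id (id_mem_fixingMaps X)
      (ε / 2) (half_pos hε)
    refine ⟨θ₁ ∘ₗ θ₂, comp_mem_fixingMaps h1 h2, fun θ hθ θ' hθ' => ?_⟩
    have e1 := hdef (θ₂ ∘ₗ θ) (comp_mem_fixingMaps h2 hθ)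
    have e2 := hdef (θ₂ ∘ₗ θ') (comp_mem_fixingMaps h2 hθ')
    have e3 := hsm θ hθ θ' hθ'
    simp only [LinearMap.comp_apply, LinearMap.mulLeft_apply, LinearMap.id_apply] at e1 e2 e3 ⊢
    have e4 : f (θ₁ (θ₂ (θ (x * w) - (s : ℂ) • θ' (x * w)))) =
        f (θ₁ (θ₂ (θ (x * w)) - x * θ₂ (θ w)))
        - s * f (θ₁ (θ₂ (θ' (x * w)) - x * θ₂ (θ' w)))
        + f (θ₁ (x * θ₂ (θ w - (s : ℂ) • θ' w))) := by
      simp only [map_sub, map_smul, smul_eq_mul, mul_sub, mul_smul_comm]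
      ring
    rw [e4]
    have e5 : ‖(s : ℂ) * f (θ₁ (θ₂ (θ' (x * w)) - x * θ₂ (θ' w)))‖ ≤
        |s| * (ε / 2 / (1 + |s|)) := by
      rw [norm_mul, Complex.norm_real, Real.norm_eq_abs]
      gcongr
    have e6 : ε / 2 / (1 + |s|) + |s| * (ε / 2 / (1 + |s|)) = ε / 2 := by
      have : (1 + |s|) ≠ 0 := by positivity
      field_simp
    refine (norm_add_le _ _).trans ?_
    have := norm_sub_le (f (θ₁ (θ₂ (θ (x * w)) - x * θ₂ (θ w))))
      (s * f (θ₁ (θ₂ (θ' (x * w)) - x * θ₂ (θ' w))))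
    linarith

lemma Vanishes.mul_left_of_mem_cstar (hX : 1 ∈ X) {a : H →L[ℂ] H} (ha : a ∈ cstar X)
    {w : H →L[ℂ] H} (hw : Vanishes X s w) : Vanishes X s (a * w) := by
  -- The claim for b* is carried along so that the induction passes through `star`.
  have hadj : ∀ b ∈ StarAlgebra.adjoin ℂ (X : Set (H →L[ℂ] H)), ∀ w, Vanishes X s w →
      Vanishes X s (b * w) ∧ Vanishes X s (Star.star b * w) := fun b hb => by
    induction hb using StarAlgebra.adjoin_induction with
    | mem x hx =>
      exact fun w hw => ⟨hw.mul_left hX fun θ hθ => hθ.2 x hx,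
        hw.mul_left hX fun θ hθ => map_eq_of_mem_fixingMaps_star hθ (by rwa [star_star])⟩
    | algebraMap r =>
      intro w hw
      rw [Algebra.algebraMap_eq_smul_one, star_smul, star_one, smul_mul_assoc, smul_mul_assoc,
        one_mul]
      exact ⟨hw.smul _, hw.smul _⟩
    | add b d _ _ hb hd =>
      intro w hw
      rw [star_add, add_mul, add_mul]
      exact ⟨(hb w hw).1.add (hd w hw).1, (hb w hw).2.add (hd w hw).2⟩
    | mul b d _ _ hb hd =>
      intro w hw
      rw [star_mul, mul_assoc, mul_assoc]
      exact ⟨(hb _ (hd w hw).1).1, (hd _ (hb w hw).2).2⟩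
    | star b _ hb =>
      intro w hw
      rw [star_star]
      exact (hb w hw).symm
  have hclosed : IsClosed {b : H →L[ℂ] H | Vanishes X s (b * w)} :=
    (isClosed_vanishes hX).preimage (by fun_prop : Continuous fun b : H →L[ℂ] H => b * w)
  have hsub : closure (StarAlgebra.adjoin ℂ (X : Set (H →L[ℂ] H)) : Set (H →L[ℂ] H)) ⊆
      {b : H →L[ℂ] H | Vanishes X s (b * w)} :=
    closure_minimal (fun b hb => (hadj b hb w hw).1) hclosed
  exact hsub ha

lemma Vanishes.mul_right_of_mem_cstar (hX : 1 ∈ X) {a : H →L[ℂ] H} (ha : a ∈ cstar X)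
    {w : H →L[ℂ] H} (hw : Vanishes X s w) : Vanishes X s (w * a) := by
  have := (hw.star.mul_left_of_mem_cstar hX (star_mem ha)).star
  rwa [star_mul, star_star, star_star] at this

/-- A boundary subsystem is asymptotically annihilated. -/
lemma IsBoundarySubsystem.vanishes {V : Submodule ℂ (H →L[ℂ] H)} (hX : 1 ∈ X)
    (h : IsBoundarySubsystem X (Subalgebra.toSubmodule (cstar X).toSubalgebra) V)
    {v : H →L[ℂ] H} (hv : v ∈ V) : Vanishes X 0 v := fun f hf ε hε => by
  obtain ⟨ψ, hψ, hψV⟩ := h.exists_fixingMap hX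
  have hone : Vanishes X 1 (1 : H →L[ℂ] H) := fun f _ ε hε =>
    ⟨LinearMap.id, id_mem_fixingMaps X, fun θ hθ θ' hθ' => by
      rw [hθ.2 1 hX, hθ'.2 1 hX]
      simpa using hε.le⟩
  -- As v = v · 1 with v in C*(X), the images of v converge; comparison with ψv = 0 then identifies
  -- the limit as 0.
  have hv1 : Vanishes X 1 v := by
    simpa using hone.mul_left_of_mem_cstar hX (h.subspace hv)
  obtain ⟨θ₀, h0, hsm⟩ := hv1 f hf ε hε
  refine ⟨θ₀, h0, fun θ hθ θ' hθ' => ?_⟩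
  simpa [hψV v hv] using hsm θ hθ ψ hψ

end Vanishing

/-! ### The vanishing ideal is the Šilov ideal -/

section Main

variable {H : Type*} [NormedAddCommGroup H] [InnerProductSpace ℂ H] [CompleteSpace H]

lemma opNorm_le_of_two_mul_re_inner {K : Type*} [NormedAddCommGroup K] [InnerProductSpace ℂ K]
    [CompleteSpace K] {S : K →L[ℂ] K} {M : ℝ} (hM : 0 ≤ M)
    (h : ∀ η ζ, -(M * (‖η‖ ^ 2 + ‖ζ‖ ^ 2)) ≤ 2 * (inner ℂ η (S ζ)).re) : ‖S‖ ≤ M := by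
  refine S.opNorm_le_bound hM fun ζ => ?_
  by_cases hS : S ζ = 0
  · rw [hS, norm_zero]
    positivity
  have hζ : 0 < ‖ζ‖ := norm_pos_iff.2 fun h0 => hS (by rw [h0, map_zero])
  have hS' : 0 < ‖S ζ‖ := norm_pos_iff.2 hS
  -- This η has norm ‖ζ‖ and points opposite to Sζ, which is the extremal case.
  have := h (((-(‖ζ‖ / ‖S ζ‖) : ℝ) : ℂ) • S ζ) ζ
  rw [norm_smul, inner_smul_left, Complex.conj_ofReal, Complex.re_ofReal_mul, re_inner_self,
    Complex.norm_real, Real.norm_eq_abs, abs_neg, abs_of_pos (by positivity),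
    div_mul_cancel₀ _ hS'.ne'] at this
  have e : -(‖ζ‖ / ‖S ζ‖) * ‖S ζ‖ ^ 2 = -(‖ζ‖ * ‖S ζ‖) := by
    field_simp
  rw [e] at this
  nlinarith

/-- Completely positive unital maps are completely contractive. -/
lemma two_mul_re_sum_ge {X : Submodule ℂ (H →L[ℂ] H)} (hX : 1 ∈ X)
    {θ : (H →L[ℂ] H) →ₗ[ℂ] (H →L[ℂ] H)} (hθ : θ ∈ fixingMaps X) {ν : ℕ}
    (a : Matrix (Fin ν) (Fin ν) (H →L[ℂ] H)) (η ζ : PiLp 2 (fun _ : Fin ν => H)) :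
    -(matrixNorm a * (‖η‖ ^ 2 + ‖ζ‖ ^ 2)) ≤
      2 * (∑ i, ∑ j, inner ℂ (η i) (θ (a i j) (ζ j))).re := by
  classical
  have hdiag : ∀ ξ : Fin ν → H, (∑ i, ∑ j, inner ℂ (ξ i)
      ((if i = j then ((matrixNorm a : ℝ) : ℂ) • (1 : H →L[ℂ] H) else 0) (ξ j))).re =
        matrixNorm a * ‖WithLp.toLp 2 ξ‖ ^ 2 := fun ξ => by
    rw [PiLp.norm_sq_eq_of_L2, Finset.mul_sum, Complex.re_sum]
    refine Finset.sum_congr rfl fun i _ => ?_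
    rw [Finset.sum_eq_single i]
    · rw [if_pos rfl, smul_apply, one_apply_eq_self, inner_smul_right, Complex.re_ofReal_mul,
        re_inner_self]
    · intro j _ hj
      rw [if_neg hj.symm, zero_apply, inner_zero_right]
    · simp
  let D : Fin ν → Fin ν → H →L[ℂ] H := fun i j =>
    if i = j then ((matrixNorm a : ℝ) : ℂ) • (1 : H →L[ℂ] H) else 0
  have hD : ∀ i j, θ (D i j) = D i j := fun i j => by
    simp only [D]
    split_ifs
    · rw [map_smul, hθ.2 1 hX]
    · exact map_zero θ
  -- The block matrix [[‖a‖, 2a], [0, ‖a‖]] is accretive, and θ fixes its scalar diagonal blocks.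
  have := hθ.1 (Fin ν ⊕ Fin ν)
    (fun p q => Sum.elim (fun i => Sum.elim (D i) (fun j => (2 : ℂ) • a i j) q)
      (fun i => Sum.elim (fun _ => 0) (D i) q) p)
    (fun ξ => by
      have h1 := two_mul_re_inner_le (matrixAction H ν (CStarMatrix.ofMatrix a))
        (WithLp.toLp 2 fun i => ξ (Sum.inl i)) (WithLp.toLp 2 fun i => ξ (Sum.inr i))
      rw [inner_matrixAction, ← matrixNorm_eq_norm_matrixAction] at h1
      have h2 := hdiag fun i => ξ (Sum.inl i)
      have h3 := hdiag fun i => ξ (Sum.inr i)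
      simp only [Fintype.sum_sum_type, Sum.elim_inl, Sum.elim_inr, smul_apply, zero_apply,
        inner_zero_right, inner_smul_right, Finset.sum_const_zero,
        Finset.sum_add_distrib, ← Finset.mul_sum, Complex.add_re, Complex.zero_re, D]
      rw [h2, h3, show ((2 : ℂ)) = ((2 : ℝ) : ℂ) by norm_num, Complex.re_ofReal_mul]
      linarith) (Sum.elim η ζ)
  have h2 := hdiag η
  have h3 := hdiag ζ
  simp only [Fintype.sum_sum_type, Sum.elim_inl, Sum.elim_inr, map_smul, map_zero, smul_apply,
    zero_apply, hD, inner_zero_right, inner_smul_right, Finset.sum_const_zero,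
    Finset.sum_add_distrib, ← Finset.mul_sum, Complex.add_re, Complex.zero_re] at this
  simp only [D] at this
  rw [h2, h3, show ((2 : ℂ)) = ((2 : ℝ) : ℂ) by norm_num, Complex.re_ofReal_mul] at this
  rw [WithLp.toLp_ofLp, WithLp.toLp_ofLp] at this
  linarith

/-- For fixed η and ζ, one θ makes the contribution of y to the form at most ε/2, fixes x, and keeps
the form of x + y within its norm bound. -/
lemma matrixNorm_le_of_vanishes {X : Submodule ℂ (H →L[ℂ] H)} (hX : 1 ∈ X) {ν : ℕ}
    {x y : Matrix (Fin ν) (Fin ν) (H →L[ℂ] H)} (hx : ∀ i j, x i j ∈ X)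
    (hy : ∀ i j, Vanishes X 0 (y i j)) : matrixNorm x ≤ matrixNorm (x + y) := by
  rw [matrixNorm_eq_norm_matrixAction x]
  refine opNorm_le_of_two_mul_re_inner (matrixNorm_nonneg _) fun η ζ => ?_
  refine le_of_forall_pos_le_add fun ε hε => ?_
  obtain ⟨θ, hθ, hsm⟩ := exists_norm_sum_le (Finset.univ : Finset (Fin ν × Fin ν))
    (h := fun p => vectorFunctional (η p.1) (ζ p.2)) (c := fun p => y p.1 p.2)
    (fun p => vectorFunctional_mem_positiveSpan _ _) (fun p => hy p.1 p.2)
    LinearMap.id (id_mem_fixingMaps X) (ε / 2) (half_pos hε)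
  have e1 := hsm LinearMap.id (id_mem_fixingMaps X) LinearMap.id (id_mem_fixingMaps X)
  have e2 := two_mul_re_sum_ge hX hθ (x + y) η ζ
  have e3 := neg_le_of_abs_le ((Complex.abs_re_le_norm (-∑ p : Fin ν × Fin ν,
    inner ℂ (η p.1) (θ (y p.1 p.2) (ζ p.2)))).trans_eq (norm_neg _))
  simp only [LinearMap.id_apply, Complex.ofReal_zero, zero_smul, sub_zero,
    vectorFunctional_apply] at e1
  rw [Fintype.sum_prod_type, Complex.neg_re] at e3
  rw [Fintype.sum_prod_type] at e1
  simp only [Matrix.add_apply, map_add, hθ.2 _ (hx _ _), add_apply, inner_add_right,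
    Finset.sum_add_distrib, Complex.add_re] at e2
  rw [inner_matrixAction]
  linarith [neg_le_of_abs_le ((Complex.abs_re_le_norm (∑ i, ∑ j,
    inner ℂ (η i) (θ (y i j) (ζ j))))), le_of_abs_le ((Complex.abs_re_le_norm (∑ i, ∑ j,
    inner ℂ (η i) (θ (y i j) (ζ j)))))]

/-- The quotient map of a C*-algebra by a closed ideal. -/
def quotientHom {A : Type*} [CStarAlgebra A] (J : Ideal A) [J.IsTwoSided]
    [IsClosed (J : Set A)] : A →⋆ₐ[ℂ] (A ⧸ J) :=
  { Ideal.Quotient.mkₐ ℂ J with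
    map_star' := fun _ => rfl }

lemma matrixNorm_map_mk_le {A : Type*} [CStarAlgebra A] (J : Ideal A) [J.IsTwoSided]
    [IsClosed (J : Set A)] {ν : ℕ} (x : Matrix (Fin ν) (Fin ν) A) :
    matrixNorm (x.map (Ideal.Quotient.mk J)) ≤ matrixNorm x :=
  matrixNorm_map_le (quotientHom J : A →⋆ₙₐ[ℂ] (A ⧸ J)) x

lemma exists_matrixNorm_add_lt_mk {A : Type*} [CStarAlgebra A] (J : Ideal A) [J.IsTwoSided]
    [IsClosed (J : Set A)] {ν : ℕ} (x : Matrix (Fin ν) (Fin ν) A) {ε : ℝ} (hε : 0 < ε) :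
    ∃ k : Matrix (Fin ν) (Fin ν) A, (∀ i j, k i j ∈ J) ∧
      matrixNorm (x + k) < matrixNorm (x.map (Ideal.Quotient.mk J)) + ε := by
  obtain ⟨k, hk, hlt⟩ := exists_matrixNorm_add_lt (quotientHom J) x hε
  exact ⟨k, fun i j => Ideal.Quotient.eq_zero_iff_mem.1 (hk i j), hlt⟩

lemma matrixNorm_map_incl (X : Submodule ℂ (H →L[ℂ] H)) {ν : ℕ}
    (a : Matrix (Fin ν) (Fin ν) (cstar X)) : matrixNorm (a.map (incl X)) = matrixNorm a :=
  matrixNorm_map_eq ((cstar X).subtype : cstar X →⋆ₙₐ[ℂ] (H →L[ℂ] H)) Subtype.val_injective a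

/-- The ideal of the asymptotically annihilated elements of `C*(X)`. -/
def vanishingIdeal (X : Submodule ℂ (H →L[ℂ] H)) (hX : 1 ∈ X) : Ideal (cstar X) where
  carrier := {c | Vanishes X 0 (c : H →L[ℂ] H)}
  add_mem' hc hd := hc.add hd
  zero_mem' := Vanishes.zero
  smul_mem' a _ hc := hc.mul_left_of_mem_cstar hX a.2

lemma isBoundaryIdeal_vanishingIdeal (X : Submodule ℂ (H →L[ℂ] H)) (hX : 1 ∈ X) :
    IsBoundaryIdeal (X.comap (incl X)) (vanishingIdeal X hX) := by
  have h1 : (vanishingIdeal X hX).IsTwoSided :=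
    ⟨fun {_} b hc => Vanishes.mul_right_of_mem_cstar hX b.2 hc⟩
  have h2 : IsClosed (vanishingIdeal X hX : Set (cstar X)) :=
    (isClosed_vanishes hX).preimage continuous_subtype_val
  refine ⟨h1, h2, fun ν x hx => ?_⟩
  refine le_antisymm (matrixNorm_map_mk_le _ x) (le_of_forall_pos_le_add fun ε hε => ?_)
  obtain ⟨k, hk, hlt⟩ := exists_matrixNorm_add_lt_mk (vanishingIdeal X hX) x hε
  refine le_trans ?_ hlt.le
  have hadd : (x + k).map (incl X) = x.map (incl X) + k.map (incl X) := by
    refine Matrix.ext fun a b => ?_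
    exact map_add (incl X) _ _
  rw [← matrixNorm_map_incl X x, ← matrixNorm_map_incl X (x + k), hadd]
  exact matrixNorm_le_of_vanishes hX hx hk

lemma IsBoundaryIdeal.isBoundarySubsystem {X : Submodule ℂ (H →L[ℂ] H)} {J : Ideal (cstar X)}
    (hJ : IsBoundaryIdeal (X.comap (incl X)) J) :
    IsBoundarySubsystem X (Subalgebra.toSubmodule (cstar X).toSubalgebra)
      ((J.restrictScalars ℂ).map (incl X)) := by
  obtain ⟨h1, h2, hiso⟩ := hJ
  have hXC : X ≤ Subalgebra.toSubmodule (cstar X).toSubalgebra := fun x hx =>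
    StarSubalgebra.le_topologicalClosure _ (StarAlgebra.subset_adjoin ℂ _ hx)
  refine ⟨⟨one_mem (cstar X), fun a ha => star_mem (s := cstar X) ha⟩, hXC, ?_, ?_, ?_⟩
  · rintro _ ⟨c, -, rfl⟩
    exact c.2
  · rintro _ ⟨c, hc, rfl⟩
    exact ⟨star c, star_mem_ideal J hc, rfl⟩
  · intro ν x hx
    have hbdd : BddBelow (Set.range fun y : {y : Matrix (Fin ν) (Fin ν) (H →L[ℂ] H) //
        ∀ i j, y i j ∈ (J.restrictScalars ℂ).map (incl X)} => matrixNorm (x + y.1)) :=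
      ⟨0, by rintro _ ⟨y, rfl⟩; exact matrixNorm_nonneg _⟩
    have hne : Nonempty {y : Matrix (Fin ν) (Fin ν) (H →L[ℂ] H) //
        ∀ i j, y i j ∈ (J.restrictScalars ℂ).map (incl X)} :=
      ⟨⟨0, fun _ _ => Submodule.zero_mem _⟩⟩
    refine le_antisymm ?_ (le_ciInf ?_)
    · refine (ciInf_le hbdd ⟨0, fun _ _ => Submodule.zero_mem _⟩).trans_eq ?_
      rw [add_zero]
    · rintro ⟨y, hy⟩
      have hy' : ∀ i j, ∃ c ∈ J, incl X c = y i j := hy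
      choose y' hyJ hyy using hy'
      let x' : Matrix (Fin ν) (Fin ν) (cstar X) := fun a b => ⟨x a b, hXC (hx a b)⟩
      have e1 : x = x'.map (incl X) := rfl
      have e3 : x + y = (x' + Matrix.of y').map (incl X) := by
        refine Matrix.ext fun a b => ?_
        change x a b + y a b = incl X (x' a b + y' a b)
        rw [map_add, hyy]
        rfl
      have e4 : (x' + Matrix.of y').map (Ideal.Quotient.mk J) = x'.map (Ideal.Quotient.mk J) := by
        refine Matrix.ext fun a b => ?_
        change Ideal.Quotient.mk J (x' a b + y' a b) = Ideal.Quotient.mk J (x' a b)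
        rw [map_add, add_eq_left]
        exact Ideal.Quotient.eq_zero_iff_mem.2 (hyJ a b)
      change matrixNorm x ≤ matrixNorm (x + y)
      rw [e3, e1, matrixNorm_map_incl, matrixNorm_map_incl]
      -- The chain is ‖x‖ = ‖q(x)‖ = ‖q(x + y)‖ ≤ ‖x + y‖.
      refine le_trans ?_ (matrixNorm_map_mk_le J _)
      rw [e4]
      exact (hiso ν x' hx).ge

lemma IsBoundarySubsystem.le_vanishingIdeal {X V : Submodule ℂ (H →L[ℂ] H)} (hX : 1 ∈ X)
    (h : IsBoundarySubsystem X (Subalgebra.toSubmodule (cstar X).toSubalgebra) V) :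
    V ≤ ((vanishingIdeal X hX).restrictScalars ℂ).map (incl X) := fun v hv =>
  ⟨⟨v, h.subspace hv⟩, h.vanishes hX hv, rfl⟩

lemma isSilovIdeal_vanishingIdeal (X : Submodule ℂ (H →L[ℂ] H)) (hX : 1 ∈ X) :
    IsSilovIdeal (X.comap (incl X)) (vanishingIdeal X hX) := by
  refine ⟨isBoundaryIdeal_vanishingIdeal X hX, fun J hJ c hc => ?_⟩
  obtain ⟨d, hd, hdc⟩ := (IsBoundaryIdeal.isBoundarySubsystem hJ).le_vanishingIdeal hX
    ⟨c, hc, rfl⟩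
  rwa [← Subtype.val_injective hdc]

end Main

end SilovBoundary
end

theorem mainTheorem5 {H : Type*} [NormedAddCommGroup H] [InnerProductSpace ℂ H] [CompleteSpace H]
    (X : Submodule ℂ (H →L[ℂ] H)) (hX : 1 ∈ X) :
    (∃ I : Ideal (SilovBoundary.cstar X),
        SilovBoundary.IsSilovIdeal (X.comap (SilovBoundary.incl X)) I) ∧
      ∀ I : Ideal (SilovBoundary.cstar X),
        SilovBoundary.IsSilovIdeal (X.comap (SilovBoundary.incl X)) I →
          IsGreatest
            {V : Submodule ℂ (H →L[ℂ] H) | SilovBoundary.IsBoundarySubsystem X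
              (Subalgebra.toSubmodule (SilovBoundary.cstar X).toSubalgebra) V}
            ((I.restrictScalars ℂ).map (SilovBoundary.incl X)) := by
  have hsilov := SilovBoundary.isSilovIdeal_vanishingIdeal X hX
  refine ⟨⟨_, hsilov⟩, fun I hI => ?_⟩
  obtain rfl : I = SilovBoundary.vanishingIdeal X hX := hI.unique hsilov
  exact ⟨SilovBoundary.IsBoundaryIdeal.isBoundarySubsystem hI.1,
    fun V hV => hV.le_vanishingIdeal hX⟩
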